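/- **Setting.** There are $N\ge 2$ buyers. Buyer $n$ has an unknown value $X_n$ (a real random variable) and privately observes a signal $Y_n$ with values in an interval $I\subseteq\mathbb R$. "Increasing" means strictly increasing. Assume: * the law of $(X_n,Y_n,\mathbf Y_{-n})$ is the same for each $n$ and symmetric in the last $N-1$ components; * $\mathbf Y=(Y_1,\dots,Y_N)$ has a density that is positive on $I^N$; versions of the density and of the conditional laws of $X_n$ given $\mathbf Y=\mathbf y$ are fixed, the latter sharing the above symmetry for every $\mathbf y\in I^N$; * for every increasing $h$, $E[h(X_1)\mid Y_i\in[a_i,b_i],\ 1\le i\le N]$ ($a_i\le b_i$ in $I$, where $a_i=b_i$ means conditioning on $Y_i=a_i$) is increasing in $a_1,b_1$ and nondecreasing in the other $a_i,b_i$, whenever it exists; * all buyers have the same utility $u:\mathbb R\to\mathbb R$, concave and increasing with $u(0)=0$, and $E[u(X_1)\mid \mathbf Y=\mathbf y]>0$ for all $\mathbf y\in I^N$. Fix $\alpha\in[0,1)$. A winner with value $x$ who pays $b$ in the auction then pays the seller $\alpha\max\{0,x-b\}$ under the profit only sharing contract (POSC), or $\alpha(x-b)$ under the profit and loss sharing contract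 (PLSC). For $y_1\in I$ and $\mathbf z\in I^{N-1}$ let $s(\alpha,y_1,\mathbf z)$ be the solution $b$ of $$E\big[u\big(X_1-b-\alpha\max\{0,X_1-b\}\big)\mid Y_1=y_1,\ \mathbf Y_{-1}=\mathbf z\big]=0,$$ and let $t(\alpha,y_1,\mathbf z)$ be the solution of $E[u((1-\alpha)(X_1-b))\mid Y_1=y_1,\mathbf Y_{-1}=\mathbf z]=0$; the order of the entries of $\mathbf z$ is irrelevant. Let $\mathbf Z=(Z_1\ge\dots\ge Z_{N-1})$ be the ordered signals of buyers $2,\dots,N$. Assume that the conditional expected utility of winning at a price $b$ given $\mathbf Y=\mathbf y$ is finite for all $b$ and all $\mathbf y\in I^N$, and that the utility of buyer 1 from winning at the price $s(\alpha,Z_1,\mathbf Z)$ (resp. $t(\alpha,Z_1,\mathbf Z)$) is integrable. In the English auction the price rises continuously from $-\infty$; the price, the number of active buyers and the past drop-out prices are public. A strategy prescribes the price at which to drop out as a function of one's own signal and of the past drop-out prices $p_1\le p_2\le\cdots$ (one drops out at once if the prescribed price has been passed); simultaneous drop-outs are ordered by a fixed priority among the buyers. The auction ends with the $(N-1)$-st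 drop-out, and the remaining buyer pays its price; losers get utility $0$. **Claim (POSC).** The number $s(\alpha,y_1,\mathbf z)$ exists and is unique for all $(y_1,\mathbf z)\in I^N$. Given drop-out prices $p_1\le p_2\le\cdots$, define recursively, for $1\le k\le N-1$, $q_k\in I$ as the solution $b$ of $$s\big(\alpha,\underbrace{b,\dots,b}_{N-k+1},q_{k-1},\dots,q_1\big)=p_k ,$$ and as an arbitrary element of $I$, depending on $p_1,\dots,p_k$ only, if there is no solution in $I$. There is at most one solution in $I$, and $q_k\le q_{k+1}$ whenever both equations are solvable. Let every buyer $n$ use the strategy $$\beta^k(y_n,p_{N-k},\dots,p_1)=s\big(\alpha,\underbrace{y_n,\dots,y_n}_{k},q_{N-k},\dots,q_1\big),\qquad 2\le k\le N,$$ where $k$ is the number of active buyers. Then this profile is a symmetric perfect Bayesian equilibrium of the English auction with the POSC, with beliefs under which the signals of the buyers who have dropped out are $q_1,q_2,\dots$: at every information set (own signal, past drop-out prices, current price) each buyer has a belief about the others' signals and about who is still active, no deviation by a measurable strategy raises his expected utility from the continuation, and beliefs follow from Bayes' rule at all information sets of a buyer that are reached when the other buyers use $\beta$ (whether or not he himself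 has deviated). **Claim (PLSC).** The same holds for the English auction with the PLSC, with $t$ in place of $s$. -/

import Mathlib

open MeasureTheory ProbabilityTheory

noncomputable section

namespace ProfitSharing

/-! ### Contracts and expected utility -/

/-- The two profit sharing contracts: profit only (`posc`), profit and loss (`plsc`). -/
inductive Contract
  | posc
  | plsc

/-- Second stage payment to the seller when the preliminary profit is `w`. -/
def Contract.payment (C : Contract) (α w : ℝ) : ℝ :=
  match C with
  | .posc => α * max 0 w
  | .plsc => α * w

/-- Total profit of a winner whose value is `x` and who pays `b` in the auction stage. -/
def profit (C : Contract) (α x b : ℝ) : ℝ := (x - b) - C.payment α (x - b)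

/-- The signal vectors all of whose entries lie in `I`. -/
def signalSpace (N : ℕ) (I : Set ℝ) : Set (Fin N → ℝ) := {y | ∀ i, y i ∈ I}

/-- Expected utility of buyer `n` from winning at the price `b`, given the vector `y` of all
signals; `κ n y` is the conditional law of his value given that vector. -/
def winUtility {N : ℕ} (κ : Fin N → Kernel (Fin N → ℝ) ℝ) (u : ℝ → ℝ) (C : Contract) (α : ℝ)
    (n : Fin N) (y : Fin N → ℝ) (b : ℝ) : ℝ :=
  ∫ x, u (profit C α x b) ∂(κ n y)

/-- The price at which the expected utility of the first buyer from winning is zero, given that his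
own signal is `y 0` and those of the others are the remaining entries of `y` (in any order): the
function `s` for the profit only contract, and `t` for the profit and loss contract. -/
def indiffPrice {N : ℕ} [NeZero N] (κ : Fin N → Kernel (Fin N → ℝ) ℝ) (u : ℝ → ℝ) (C : Contract)
    (α : ℝ) (y : Fin N → ℝ) : ℝ :=
  Classical.epsilon fun b => winUtility κ u C α 0 y b = 0

/-! ### The model -/

/-- Reference measure on the box `∏ [a i, b i]`: Lebesgue measure in the coordinates with
`a i < b i`, a point mass in the coordinates with `a i = b i`. -/
def boxMeasure {N : ℕ} (a b : Fin N → ℝ) : Measure (Fin N → ℝ) :=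
  Measure.pi fun i => if a i = b i then Measure.dirac (a i) else volume.restrict (Set.Icc (a i) (b i))

/-- The unnormalized law of the signals on the box, when they have density `f`. -/
def boxWeight {N : ℕ} (f : (Fin N → ℝ) → ℝ) (a b : Fin N → ℝ) : Measure (Fin N → ℝ) :=
  (boxMeasure a b).withDensity fun y => ENNReal.ofReal (f y)

/-- The conditional law of a value given that the signals lie in the box `∏ [a i, b i]`, when `k`
is its conditional law given the signals. -/
def boxLaw {N : ℕ} (f : (Fin N → ℝ) → ℝ) (k : Kernel (Fin N → ℝ) ℝ) (a b : Fin N → ℝ) :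
    Measure ℝ :=
  ((boxWeight f a b Set.univ)⁻¹ • boxWeight f a b).bind k

/-- The conditional expectation of `h` of the value given the box exists and is finite. -/
def BoxExpExists {N : ℕ} (f : (Fin N → ℝ) → ℝ) (k : Kernel (Fin N → ℝ) ℝ) (h : ℝ → ℝ)
    (a b : Fin N → ℝ) : Prop :=
  boxWeight f a b Set.univ ≠ ⊤ ∧ Integrable h (boxLaw f k a b)

/-- The symmetric interdependent values model with `N` buyers. `X n` and `Y n` are the value and
the signal of buyer `n`, `I` is the interval of signals, `f` the density of the signal vector,
`κ n` (a version of) the conditional law of `X n` given the signal vector, `u` the utility. -/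
structure Model {Ω : Type*} [MeasurableSpace Ω] (P : Measure Ω) {N : ℕ} [NeZero N]
    (X Y : Fin N → Ω → ℝ) (I : Set ℝ) (f : (Fin N → ℝ) → ℝ)
    (κ : Fin N → Kernel (Fin N → ℝ) ℝ) (u : ℝ → ℝ) : Prop where
  measurable_X : ∀ n, Measurable (X n)
  measurable_Y : ∀ n, Measurable (Y n)
  interval : I.OrdConnected
  signal_mem : ∀ n ω, Y n ω ∈ I
  /-- The law of `(X n, Y n, Y_{-n})` is the same for each `n` and symmetric in the last `N - 1`
  components. -/
  law_symm : ∀ (π : Equiv.Perm (Fin N)) (n : Fin N),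
    P.map (fun ω => (X (π n) ω, fun i => Y (π i) ω)) = P.map (fun ω => (X n ω, fun i => Y i ω))
  measurable_f : Measurable f
  density : P.map (fun ω i => Y i ω) = volume.withDensity fun y => ENNReal.ofReal (f y)
  density_pos : ∀ y ∈ signalSpace N I, 0 < f y
  markov : ∀ n, IsMarkovKernel (κ n)
  /-- `κ n` is a regular conditional law of `X n` given the signal vector. -/
  cond_law : ∀ n, P.map (fun ω => ((fun i => Y i ω), X n ω)) = (P.map fun ω i => Y i ω) ⊗ₘ κ n
  /-- The versions of the conditional laws have the symmetry of the joint law. -/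
  cond_symm : ∀ (π : Equiv.Perm (Fin N)) (n : Fin N), ∀ y ∈ signalSpace N I,
    κ (π n) y = κ n fun i => y (π i)
  /-- Positive dependence: `E[h(X 0) | Y i ∈ [a i, b i] for all i]` is increasing in `a 0` and
  `b 0`, and nondecreasing in the other `a i` and `b i`. -/
  pos_dep : ∀ h : ℝ → ℝ, StrictMono h → ∀ a b a' b' : Fin N → ℝ,
    a ∈ signalSpace N I → b ∈ signalSpace N I → a' ∈ signalSpace N I → b' ∈ signalSpace N I →
    a ≤ b → a' ≤ b' → a ≤ a' → b ≤ b' →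
    BoxExpExists f (κ 0) h a b → BoxExpExists f (κ 0) h a' b' →
    (∫ x, h x ∂(boxLaw f (κ 0) a b) ≤ ∫ x, h x ∂(boxLaw f (κ 0) a' b')) ∧
    ((a 0 < a' 0 ∨ b 0 < b' 0) →
      ∫ x, h x ∂(boxLaw f (κ 0) a b) < ∫ x, h x ∂(boxLaw f (κ 0) a' b'))
  concave : ConcaveOn ℝ Set.univ u
  increasing : StrictMono u
  normalized : u 0 = 0
  utility_pos : ∀ y ∈ signalSpace N I, Integrable u (κ 0 y) ∧ 0 < ∫ x, u x ∂(κ 0 y)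

/-- Finiteness of the expected utilities that occur in the auction: those of winning at a given
price conditional on the signals, and that of winning at the price `s(α, Z 1, Z)`. -/
structure FiniteUtilities {Ω : Type*} [MeasurableSpace Ω] (P : Measure Ω) {N : ℕ} [NeZero N]
    (X Y : Fin N → Ω → ℝ) (I : Set ℝ) (κ : Fin N → Kernel (Fin N → ℝ) ℝ) (u : ℝ → ℝ)
    (C : Contract) (α : ℝ) : Prop where
  conditional : ∀ y ∈ signalSpace N I, ∀ b : ℝ, Integrable (fun x => u (profit C α x b)) (κ 0 y)
  winning : Integrable (fun ω => u (profit C α (X 0 ω)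
    (indiffPrice κ u C α
      (Function.update (fun i => Y i ω) 0 (⨆ j : {j : Fin N // j ≠ 0}, Y j ω))))) P

/-! ### The English auction -/

/-- A strategy: the price at which the buyer drops out, as a function of his signal and of the list
`[p_m, …, p_1]` of the drop-out prices so far, most recent first. -/
abbrev Strategy := ℝ → List ℝ → ℝ

/-- The price shown by the clock just after the last drop-out; `⊥` before the first one. -/
def clock : List ℝ → EReal
  | [] => ⊥
  | p :: _ => (p : EReal)

/-- The price at which buyer `i` drops out if the drop-out prices so far are `h`, the clock shows
`c`, and no one else drops out before: at once if the price his strategy names has passed. -/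
def exitPrice {N : ℕ} (σ : Fin N → Strategy) (y : Fin N → ℝ) (h : List ℝ) (c : EReal)
    (i : Fin N) : ℝ :=
  (max c ((σ i (y i) h : ℝ) : EReal)).toReal

/-- The buyer in `D` who leaves first if they leave at the prices `b`; ties are resolved by the
priority order `ρ`. -/
def firstOut {N : ℕ} [NeZero N] (ρ : Equiv.Perm (Fin N)) (b : Fin N → ℝ) (D : Finset (Fin N)) :
    Fin N :=
  Classical.epsilon fun i => i ∈ D ∧ ∀ j ∈ D, b i < b j ∨ (b i = b j ∧ ρ i ≤ ρ j)

/-- Winner and price when the auction goes on for `k` more drop-outs from the situation in which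
the drop-out prices so far are `h`, the clock shows `c`, and the active buyers are `S`. -/
def play {N : ℕ} [NeZero N] (ρ : Equiv.Perm (Fin N)) (σ : Fin N → Strategy) (y : Fin N → ℝ) :
    ℕ → List ℝ → EReal → Finset (Fin N) → Fin N × ℝ
  | 0, _, c, S => (Classical.epsilon fun i => i ∈ S, c.toReal)
  | k + 1, h, c, S =>
    let i := firstOut ρ (exitPrice σ y h c) S
    let p := exitPrice σ y h c i
    play ρ σ y k (p :: h) (p : EReal) (S.erase i)

/-- Drop-out prices and active buyers after `m` drop-outs, if buyer `n` stays in. -/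
def pathStaying {N : ℕ} [NeZero N] (ρ : Equiv.Perm (Fin N)) (σ : Fin N → Strategy)
    (y : Fin N → ℝ) (n : Fin N) : ℕ → List ℝ × Finset (Fin N)
  | 0 => ([], Finset.univ)
  | m + 1 =>
    let s := pathStaying ρ σ y n m
    let b := exitPrice σ y s.1 (clock s.1)
    let i := firstOut ρ b (s.2.erase n)
    (b i :: s.1, s.2.erase i)

/-- What buyer `n` has observed after `m` drop-outs, if he stays in: his own signal and the
drop-out prices. -/
def observed {N : ℕ} [NeZero N] (ρ : Equiv.Perm (Fin N)) (σ : Fin N → Strategy) (n : Fin N)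
    (m : ℕ) (y : Fin N → ℝ) : ℝ × (Fin m → ℝ) :=
  (y n, fun j => (pathStaying ρ σ y n m).1.getD j 0)

/-! ### Perfect Bayesian equilibrium -/

/-- A node of an information set: the vector of signals and the set of active buyers. -/
abbrev Node (N : ℕ) := (Fin N → ℝ) × Finset (Fin N)

/-- Beliefs: for each buyer, own signal, list of drop-out prices and clock price, a law on nodes. -/
abbrev Beliefs (N : ℕ) := Fin N → ℝ → List ℝ → EReal → Measure (Node N)

/-- An active buyer with signal `y` may observe the drop-out prices `h` and the clock price `c`
while the auction is still on. The case `c = ⊥` is the start of the auction. -/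
structure IsInfoSet (N : ℕ) (I : Set ℝ) (y : ℝ) (h : List ℝ) (c : EReal) : Prop where
  signal_mem : y ∈ I
  length_le : h.length + 2 ≤ N
  sorted : h.Pairwise (· ≥ ·)
  clock_le : clock h ≤ c
  lt_top : c < ⊤

/-- Measurability of a strategy. -/
def Strategy.IsMeasurable (τ : Strategy) : Prop :=
  ∀ m : ℕ, Measurable fun z : ℝ × (Fin m → ℝ) => τ z.1 (List.ofFn z.2)

/-- Payoff of buyer `n` from the continuation of the auction at a node; `V n y b` is his expected
utility from winning at price `b` given the signals `y`, and losers get `0`. -/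
def nodePayoff {N : ℕ} [NeZero N] (V : Fin N → (Fin N → ℝ) → ℝ → ℝ) (ρ : Equiv.Perm (Fin N))
    (σ : Fin N → Strategy) (n : Fin N) (h : List ℝ) (c : EReal) (d : Node N) : ℝ :=
  let o := play ρ σ d.1 (d.2.card - 1) h c d.2
  if o.1 = n then V n d.1 o.2 else 0

/-- `(σ, μ)` is a perfect Bayesian equilibrium of the English auction. -/
structure IsPBE {Ω : Type*} [MeasurableSpace Ω] (P : Measure Ω) {N : ℕ} [NeZero N]
    (Y : Fin N → Ω → ℝ) (I : Set ℝ) (V : Fin N → (Fin N → ℝ) → ℝ → ℝ)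
    (ρ : Equiv.Perm (Fin N)) (σ : Fin N → Strategy) (μ : Beliefs N) : Prop where
  /-- Beliefs are probability measures on the nodes of the information set. -/
  belief_prob : ∀ n y h c, IsInfoSet N I y h c → IsProbabilityMeasure (μ n y h c)
  belief_support : ∀ n y h c, IsInfoSet N I y h c → ∀ᵐ d ∂(μ n y h c),
    d.1 ∈ signalSpace N I ∧ d.1 n = y ∧ n ∈ d.2 ∧ d.2.card + h.length = N
  /-- Bayes' rule, wherever the other buyers' strategies leave positive probability, whether or not
  buyer `n` himself has followed his own strategy. Suppose he looks at the clock at the price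
  `c = T (own signal, drop-out prices)`; on the event `A` that this happens after the `m`-th and
  before the next drop-out, his belief is the conditional law of the node given his observations.
  The rule `T` ranges over constant prices, over the price of the last drop-out, and so on. -/
  bayes : ∀ (n : Fin N) (m : ℕ), m + 2 ≤ N →
    ∀ T : ℝ × (Fin m → ℝ) → EReal, Measurable T →
    ∀ A : Set Ω, A = {ω |
      clock (pathStaying ρ σ (fun i => Y i ω) n m).1 ≤ T (observed ρ σ n m fun i => Y i ω) ∧
      T (observed ρ σ n m fun i => Y i ω) < clock (pathStaying ρ σ (fun i => Y i ω) n (m + 1)).1} →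
    ∀ B : Set (Node N), MeasurableSet B →
      (fun ω => (μ n (Y n ω) (pathStaying ρ σ (fun i => Y i ω) n m).1
          (T (observed ρ σ n m fun i => Y i ω))).real B)
        =ᵐ[P[|A]]
      (P[|A])[Set.indicator
          {ω | ((fun i => Y i ω), (pathStaying ρ σ (fun i => Y i ω) n m).2) ∈ B}
          (fun _ => (1 : ℝ)) |
        MeasurableSpace.comap (fun ω => observed ρ σ n m fun i => Y i ω) inferInstance]
  /-- Sequential rationality at every information set. -/
  payoff_integrable : ∀ n y h c, IsInfoSet N I y h c →
    Integrable (nodePayoff V ρ σ n h c) (μ n y h c)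
  rational : ∀ n y h c, IsInfoSet N I y h c → ∀ τ : Strategy, τ.IsMeasurable →
    Integrable (nodePayoff V ρ (Function.update σ n τ) n h c) (μ n y h c) ∧
    ∫ d, nodePayoff V ρ (Function.update σ n τ) n h c d ∂(μ n y h c)
      ≤ ∫ d, nodePayoff V ρ σ n h c d ∂(μ n y h c)

/-! ### The candidate strategy -/

/-- The vector `(y, …, y, q_m, …, q_1)` of length `N`, where `qs = [q_m, …, q_1]`. -/
def stack (N : ℕ) (y : ℝ) (qs : List ℝ) : Fin N → ℝ :=
  fun i => (List.replicate (N - qs.length) y ++ qs).getD i y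

/-- The list `[q_m, …, q_1]` of signals inferred from `[p_m, …, p_1]`, where `q [p_k, …, p_1]` is
the signal inferred for the `k`-th buyer to drop out. -/
def inferred (q : List ℝ → ℝ) : List ℝ → List ℝ
  | [] => []
  | p :: h => q (p :: h) :: inferred q h

/-- The equation `w (b, …, b, q_{k-1}, …, q_1) = p` that defines `q_k`, where `h` lists
`p_{k-1}, …, p_1`. -/
def SignalEq {N : ℕ} (w : (Fin N → ℝ) → ℝ) (q : List ℝ → ℝ) (h : List ℝ) (p b : ℝ) : Prop :=
  w (stack N b (inferred q h)) = p

/-- `q` is an inference rule: `q_k` is a signal, and it solves its defining equation whenever that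
equation has a solution. After a price for which there is none (such prices do not occur if all
buyers use the candidate strategy) it may be any signal. -/
structure IsInference {N : ℕ} (w : (Fin N → ℝ) → ℝ) (I : Set ℝ) (q : List ℝ → ℝ) : Prop where
  mem : ∀ p h, q (p :: h) ∈ I
  solves : ∀ p h, h.length + 2 ≤ N → (∃ b ∈ I, SignalEq w q h p b) → SignalEq w q h p (q (p :: h))

/-- The strategy `β^k (y, p_{N-k}, …, p_1) = w (y, …, y, q_{N-k}, …, q_1)`. -/
def bid {N : ℕ} (w : (Fin N → ℝ) → ℝ) (q : List ℝ → ℝ) : Strategy :=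
  fun y h => w (stack N y (inferred q h))

end ProfitSharing

end

/-!
Expected utility from winning is strictly decreasing in the price, so the indifference price `w` is
well defined and inherits from the conditional laws that it is nondecreasing in all signals and
increasing in the own one. Hence bidders who use the candidate strategy leave in the order of their
signals, and every drop-out price reveals the signal of the one who left. If buyer `n` outlasts such
opponents, he pays `w (z, z, …)`, where the `…` are the others' remaining signals and `z` is the
highest of all; this price does not depend on his own strategy. He can only choose between winning
at it and getting `0`, and the candidate strategy makes the better choice whatever the others'
signals are. It is therefore optimal under any belief concentrated on nodes at which those who have
left have the inferred signals and those who are active have not passed their planned prices: where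
Bayes' rule applies its beliefs are of this kind, and elsewhere a point mass can be chosen.
-/

open Filter Topology

noncomputable section

namespace ProfitSharing

/-! ### Indifference prices -/

section ExpectedUtility

variable {C : Contract} {α : ℝ}

theorem profit_eq_sub (C : Contract) (α x b : ℝ) : profit C α x b = profit C α (x - b) 0 := by
  simp [profit]

theorem strictMono_profit (C : Contract) (hα : α < 1) (b : ℝ) :
    StrictMono fun x => profit C α x b := by
  intro x x' hx
  cases C
  · simp only [profit, Contract.payment]
    rcases le_or_gt b x with h | h
    · rw [max_eq_right (by linarith), max_eq_right (by linarith)]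
      nlinarith
    · rw [max_eq_left (by linarith)]
      rcases max_cases 0 (x' - b) with ⟨h', _⟩ | ⟨h', _⟩ <;> rw [h'] <;> nlinarith
  · simp only [profit, Contract.payment]
    nlinarith

theorem strictAnti_profit (C : Contract) (hα : α < 1) (x : ℝ) :
    StrictAnti fun b => profit C α x b := by
  intro b c hbc
  simp only [profit_eq_sub C α x]
  exact strictMono_profit C hα 0 (sub_lt_sub_left hbc x)

theorem concaveOn_profit (C : Contract) (hα : 0 ≤ α) (x : ℝ) :
    ConcaveOn ℝ Set.univ fun b => profit C α x b := by
  have hsub : ConvexOn ℝ Set.univ fun b : ℝ => x - b :=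
    (convexOn_const x convex_univ).sub (concaveOn_id convex_univ)
  have hsub' : ConcaveOn ℝ Set.univ fun b : ℝ => x - b :=
    (concaveOn_const x convex_univ).sub (convexOn_id convex_univ)
  cases C
  · exact hsub'.sub (((convexOn_const 0 convex_univ).sup hsub).smul hα)
  · exact hsub'.sub (hsub.smul hα)

theorem measurable_profit (C : Contract) (α : ℝ) :
    Measurable fun z : ℝ × ℝ => profit C α z.1 z.2 := by
  cases C <;> simp only [profit, Contract.payment] <;> fun_prop

theorem tendsto_profit_atTop (C : Contract) (hα : α < 1) (b : ℝ) :
    Tendsto (fun x => profit C α x b) atTop atTop := by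
  refine tendsto_atTop_mono' _ (f₁ := fun x => (1 - α) * (x - b)) ?_
    ((tendsto_atTop_add_const_right _ (-b) tendsto_id).const_mul_atTop (sub_pos.2 hα))
  filter_upwards [eventually_ge_atTop b] with x hx
  cases C <;>
    simp only [profit, Contract.payment, max_eq_right (sub_nonneg.2 hx)] <;> linarith

theorem tendsto_profit_atBot (C : Contract) (hα : α < 1) (x : ℝ) :
    Tendsto (fun b => profit C α x b) atBot atTop := by
  simp only [profit_eq_sub C α x]
  exact (tendsto_profit_atTop C hα 0).comp
    (tendsto_atTop_add_const_left _ x tendsto_neg_atBot_atTop)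

theorem tendsto_atBot_of_concaveOn_of_strictAnti {g : ℝ → ℝ} (hconc : ConcaveOn ℝ Set.univ g)
    (hanti : StrictAnti g) : Tendsto g atTop atBot := by
  have hslope : 0 < g 0 - g 1 := sub_pos.2 (hanti one_pos)
  refine tendsto_atBot_mono' (f₁ := fun z => g 1 + -((g 0 - g 1) * (z + -1))) _ ?_
    (tendsto_atBot_add_const_left _ _ (tendsto_neg_atTop_atBot.comp
      ((tendsto_atTop_add_const_right _ (-1) tendsto_id).const_mul_atTop hslope)))
  filter_upwards [eventually_gt_atTop 1] with z hz
  have h := hconc.slope_anti_adjacent (Set.mem_univ 0) (Set.mem_univ z) one_pos hz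
  rw [div_le_iff₀ (sub_pos.2 hz)] at h
  linarith

variable {u : ℝ → ℝ} {μ : Measure ℝ}

theorem strictAnti_integral_utility [NeZero μ] (hα : α < 1) (hu : StrictMono u)
    (hint : ∀ b, Integrable (fun x => u (profit C α x b)) μ) :
    StrictAnti fun b => ∫ x, u (profit C α x b) ∂μ := by
  intro b c hbc
  have hlt : ∀ x, 0 < u (profit C α x b) - u (profit C α x c) := fun x =>
    sub_pos.2 (hu (strictAnti_profit C hα x hbc))
  rw [← sub_pos, ← integral_sub (hint b) (hint c),
    integral_pos_iff_support_of_nonneg (fun x => (hlt x).le) ((hint b).sub (hint c)),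
    Set.eq_univ_of_forall fun x => Function.mem_support.2 (hlt x).ne']
  exact Measure.measure_univ_pos.2 (NeZero.ne μ)

theorem concaveOn_integral_utility (hα : 0 ≤ α) (hu : Monotone u)
    (hconc : ConcaveOn ℝ Set.univ u) (hint : ∀ b, Integrable (fun x => u (profit C α x b)) μ) :
    ConcaveOn ℝ Set.univ fun b => ∫ x, u (profit C α x b) ∂μ := by
  refine ⟨convex_univ, fun b _ c _ s t hs ht hst => ?_⟩
  simp only [smul_eq_mul]
  rw [← integral_const_mul, ← integral_const_mul,
    ← integral_add ((hint b).const_mul s) ((hint c).const_mul t)]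
  refine integral_mono (((hint b).const_mul s).add ((hint c).const_mul t)) (hint _) fun x => ?_
  exact (hconc.2 (Set.mem_univ _) (Set.mem_univ _) hs ht hst).trans
    (hu ((concaveOn_profit C hα x).2 (Set.mem_univ b) (Set.mem_univ c) hs ht hst))

-- Truncating the utility at a positive level `u a` makes monotone convergence applicable without
-- any bound on `u`.
theorem exists_integral_utility_pos [IsProbabilityMeasure μ] (hα : α < 1) (hu : Monotone u)
    {a : ℝ} (ha : 0 < u a) (hint : ∀ b, Integrable (fun x => u (profit C α x b)) μ) :
    ∃ b, 0 < ∫ x, u (profit C α x b) ∂μ := by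
  have hmin : ∀ k : ℕ, Integrable (fun x => min (u (profit C α x (-k))) (u a)) μ :=
    fun k => (hint _).inf (integrable_const _)
  have hmono : ∀ x, Monotone fun k : ℕ => min (u (profit C α x (-k))) (u a) := fun x k l hkl =>
    min_le_min_right _ (hu ((strictAnti_profit C hα x).antitone (by simpa using hkl)))
  have hlim : ∀ x, Tendsto (fun k : ℕ => min (u (profit C α x (-k))) (u a)) atTop (𝓝 (u a)) := by
    intro x
    refine tendsto_const_nhds.congr' ?_
    have hprofit : Tendsto (fun k : ℕ => profit C α x (-k)) atTop atTop :=
      (tendsto_profit_atBot C hα x).comp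
        (tendsto_neg_atTop_atBot.comp tendsto_natCast_atTop_atTop)
    filter_upwards [hprofit.eventually_ge_atTop a] with k hk using (min_eq_right (hu hk)).symm
  have hconv := integral_tendsto_of_tendsto_of_monotone hmin (integrable_const (u a))
    (ae_of_all _ hmono) (ae_of_all _ hlim)
  obtain ⟨k, hk⟩ := (hconv.eventually_const_lt (by simpa using ha)).exists
  exact ⟨-k, hk.trans_le (integral_mono (hmin k) (hint _) fun x => min_le_left _ _)⟩

theorem existsUnique_integral_utility_eq_zero [IsProbabilityMeasure μ] (hα0 : 0 ≤ α) (hα1 : α < 1)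
    (hu : StrictMono u) (hconc : ConcaveOn ℝ Set.univ u) {a : ℝ} (ha : 0 < u a)
    (hint : ∀ b, Integrable (fun x => u (profit C α x b)) μ) :
    ∃! b, ∫ x, u (profit C α x b) ∂μ = 0 := by
  have hanti := strictAnti_integral_utility hα1 hu hint
  have hconc' := concaveOn_integral_utility hα0 hu.monotone hconc hint
  have hcont := continuousOn_univ.1 (hconc'.continuousOn isOpen_univ)
  obtain ⟨b, hb⟩ := exists_integral_utility_pos hα1 hu.monotone ha hint
  obtain ⟨c, hc⟩ :=
    ((tendsto_atBot_of_concaveOn_of_strictAnti hconc' hanti).eventually_lt_atBot 0).exists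
  obtain ⟨p, hp⟩ := mem_range_of_exists_le_of_exists_ge hcont ⟨c, hc.le⟩ ⟨b, hb.le⟩
  exact ⟨p, hp, fun p' hp' => hanti.injective (hp'.trans hp.symm)⟩

end ExpectedUtility

section DegenerateBox

variable {N : ℕ} {f : (Fin N → ℝ) → ℝ} {a : Fin N → ℝ}

theorem boxMeasure_self (a : Fin N → ℝ) : boxMeasure a a = Measure.dirac a := by
  simp only [boxMeasure, if_true]
  refine Measure.pi_eq fun s hs => ?_
  rw [Measure.dirac_apply' _ (MeasurableSet.univ_pi hs)]
  by_cases h : ∀ i, a i ∈ s i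
  · simp [h]
  · obtain ⟨i, hi⟩ := not_forall.1 h
    rw [Set.indicator_of_notMem (by simpa using h),
      Finset.prod_eq_zero (Finset.mem_univ i) (by simp [hi])]

theorem boxWeight_self (hf : Measurable f) (a : Fin N → ℝ) :
    boxWeight f a a = ENNReal.ofReal (f a) • Measure.dirac a := by
  classical
  ext s hs
  rw [boxWeight, boxMeasure_self, withDensity_apply _ hs, setLIntegral_dirac' (by fun_prop) hs]
  by_cases ha : a ∈ s <;> simp [hs, ha]

theorem boxLaw_self (hf : Measurable f) (k : Kernel (Fin N → ℝ) ℝ) (ha : 0 < f a) :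
    boxLaw f k a a = k a := by
  have hnormalized : ((ENNReal.ofReal (f a) • Measure.dirac a : Measure (Fin N → ℝ)) Set.univ)⁻¹ •
      ENNReal.ofReal (f a) • Measure.dirac a = Measure.dirac a := by
    rw [smul_smul]
    simp [ENNReal.inv_mul_cancel (ENNReal.ofReal_pos.2 ha).ne' ENNReal.ofReal_ne_top]
  rw [boxLaw, boxWeight_self hf, hnormalized, Measure.dirac_bind k.measurable]

theorem boxExpExists_self (hf : Measurable f) (k : Kernel (Fin N → ℝ) ℝ) (ha : 0 < f a)
    {h : ℝ → ℝ} (hh : Integrable h (k a)) : BoxExpExists f k h a a := by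
  refine ⟨?_, by rwa [boxLaw_self hf k ha]⟩
  rw [boxWeight_self hf]
  simp

end DegenerateBox

/-- The interdependent values model without a density of the signals: positive dependence refers to
the conditional laws given the exact signal vectors instead of those given a box. -/
structure ConditionalModel {Ω : Type*} [MeasurableSpace Ω] (P : Measure Ω) {N : ℕ} [NeZero N]
    (X Y : Fin N → Ω → ℝ) (I : Set ℝ) (κ : Fin N → Kernel (Fin N → ℝ) ℝ) (u : ℝ → ℝ) : Prop where
  measurable_X : ∀ n, Measurable (X n)
  measurable_Y : ∀ n, Measurable (Y n)
  measurableSet_I : MeasurableSet I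
  signal_mem : ∀ n ω, Y n ω ∈ I
  law_symm : ∀ (π : Equiv.Perm (Fin N)) (n : Fin N),
    P.map (fun ω => (X (π n) ω, fun i => Y (π i) ω)) = P.map (fun ω => (X n ω, fun i => Y i ω))
  markov : ∀ n, IsMarkovKernel (κ n)
  cond_law : ∀ n, P.map (fun ω => ((fun i => Y i ω), X n ω)) = (P.map fun ω i => Y i ω) ⊗ₘ κ n
  cond_symm : ∀ (π : Equiv.Perm (Fin N)) (n : Fin N), ∀ y ∈ signalSpace N I,
    κ (π n) y = κ n (y ∘ π)
  pos_dep : ∀ h : ℝ → ℝ, StrictMono h → ∀ y ∈ signalSpace N I, ∀ y' ∈ signalSpace N I, y ≤ y' →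
    Integrable h (κ 0 y) → Integrable h (κ 0 y') →
    ∫ x, h x ∂(κ 0 y) ≤ ∫ x, h x ∂(κ 0 y') ∧
      (y 0 < y' 0 → ∫ x, h x ∂(κ 0 y) < ∫ x, h x ∂(κ 0 y'))
  concave : ConcaveOn ℝ Set.univ u
  increasing : StrictMono u
  normalized : u 0 = 0

/-- What the analysis of the auction uses about the price `w` at which the first buyer is
indifferent and about the expected utility `V n y b` of buyer `n` from winning at the price `b`,
given the signals `y`. -/
structure IsPriceRule {N : ℕ} [NeZero N] (I : Set ℝ) (w : (Fin N → ℝ) → ℝ)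
    (V : Fin N → (Fin N → ℝ) → ℝ → ℝ) : Prop where
  mono : MonotoneOn w (signalSpace N I)
  strict : ∀ {y y'}, y ∈ signalSpace N I → y' ∈ signalSpace N I → y ≤ y' → y 0 < y' 0 → w y < w y'
  symm : ∀ {y} (π : Equiv.Perm (Fin N)), y ∈ signalSpace N I → π 0 = 0 → w (y ∘ π) = w y
  nonneg : ∀ {y} (n : Fin N) {b : ℝ}, y ∈ signalSpace N I → b ≤ w (y ∘ Equiv.swap 0 n) → 0 ≤ V n y b
  nonpos : ∀ {y} (n : Fin N) {b : ℝ}, y ∈ signalSpace N I → w (y ∘ Equiv.swap 0 n) ≤ b → V n y b ≤ 0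

section SignalSpace

variable {N : ℕ} {I : Set ℝ} {y : Fin N → ℝ}

theorem comp_mem_signalSpace (hy : y ∈ signalSpace N I) (g : Fin N → Fin N) :
    y ∘ g ∈ signalSpace N I := fun i => hy (g i)

theorem update_mem_signalSpace (hy : y ∈ signalSpace N I) (n : Fin N) {a : ℝ} (ha : a ∈ I) :
    Function.update y n a ∈ signalSpace N I := by
  intro i
  rw [Function.update_apply]
  split_ifs
  exacts [ha, hy i]

theorem measurableSet_signalSpace (hI : MeasurableSet I) : MeasurableSet (signalSpace N I) := by
  rw [show signalSpace N I = Set.univ.pi fun _ => I by ext y; simp [signalSpace]]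
  exact MeasurableSet.univ_pi fun _ => hI

end SignalSpace

theorem IsPriceRule.congr {N : ℕ} [NeZero N] {I : Set ℝ} {w w' : (Fin N → ℝ) → ℝ}
    {V : Fin N → (Fin N → ℝ) → ℝ → ℝ} (R : IsPriceRule I w V)
    (hw : Set.EqOn w w' (signalSpace N I)) : IsPriceRule I w' V where
  mono := R.mono.congr hw
  strict hy hy' := hw hy ▸ hw hy' ▸ R.strict hy hy'
  symm π hy := hw hy ▸ hw (comp_mem_signalSpace hy π) ▸ R.symm π hy
  nonneg n _ hy := hw (comp_mem_signalSpace hy _) ▸ R.nonneg n hy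
  nonpos n _ hy := hw (comp_mem_signalSpace hy _) ▸ R.nonpos n hy

section TopOther

variable {N : ℕ} {I : Set ℝ} {y : Fin N → ℝ}

/-- The highest signal of the buyers other than `n`. -/
def topOther (n : Fin N) (y : Fin N → ℝ) : ℝ := ⨆ j : {j : Fin N // j ≠ n}, y j

theorem exists_eq_topOther (hN : 2 ≤ N) (n : Fin N) (y : Fin N → ℝ) :
    ∃ j, j ≠ n ∧ y j = topOther n y := by
  have : Nontrivial (Fin N) := Fin.nontrivial_iff_two_le.2 hN
  have : Nonempty {j : Fin N // j ≠ n} := nonempty_subtype.2 (exists_ne n)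
  obtain ⟨j, hj⟩ := exists_eq_ciSup_of_finite (f := fun j : {j : Fin N // j ≠ n} => y j)
  exact ⟨j, j.2, hj⟩

theorem topOther_mem (hN : 2 ≤ N) (n : Fin N) (hy : y ∈ signalSpace N I) : topOther n y ∈ I := by
  obtain ⟨j, -, hj⟩ := exists_eq_topOther hN n y
  exact hj ▸ hy j

theorem measurable_topOther (n : Fin N) : Measurable (topOther n) :=
  Measurable.iSup fun j => measurable_pi_apply (j : Fin N)

end TopOther

section FinalPrice

variable {N : ℕ} [NeZero N] {w : (Fin N → ℝ) → ℝ}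

/-- The price paid by buyer `n` if he wins and the highest signal of the others is `m`: the price
`w` of a first buyer who has this signal too. -/
def finalPrice (w : (Fin N → ℝ) → ℝ) (n : Fin N) (y : Fin N → ℝ) (m : ℝ) : ℝ :=
  w (Function.update (y ∘ Equiv.swap 0 n) 0 m)

/-- Expected utility of buyer `n` from winning at the price that he pays if he stays in until all
others have left. -/
def stayUtility (V : Fin N → (Fin N → ℝ) → ℝ → ℝ) (w : (Fin N → ℝ) → ℝ) (n : Fin N)
    (y : Fin N → ℝ) : ℝ :=
  V n y (finalPrice w n y (topOther n y))

theorem topOther_comp_swap (n : Fin N) (y : Fin N → ℝ) :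
    topOther 0 (y ∘ Equiv.swap 0 n) = topOther n y := by
  have h : ∀ j : Fin N, j ≠ 0 ↔ Equiv.swap 0 n j ≠ n := fun j => by
    rw [Ne, Ne, Equiv.swap_apply_eq_iff, Equiv.swap_apply_right]
  exact Equiv.iSup_congr ((Equiv.swap 0 n).subtypeEquiv h) fun j => rfl

theorem measurable_finalPrice (hw : Measurable w) (n : Fin N) :
    Measurable fun y => finalPrice w n y (topOther n y) := by
  refine hw.comp (measurable_pi_lambda _ fun i => ?_)
  simp only [Function.update_apply]
  split_ifs
  exacts [measurable_topOther n, measurable_pi_apply _]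

end FinalPrice

theorem measurable_utility_profit {u : ℝ → ℝ} (hu : Monotone u) (C : Contract) (α : ℝ) :
    Measurable fun z : ℝ × ℝ => u (profit C α z.1 z.2) :=
  hu.measurable.comp (measurable_profit C α)

theorem measurable_winUtility {N : ℕ} {κ : Fin N → Kernel (Fin N → ℝ) ℝ} {u : ℝ → ℝ}
    {C : Contract} {α : ℝ} (n : Fin N) [IsSFiniteKernel (κ n)] (hu : Monotone u)
    {F : (Fin N → ℝ) → ℝ} (hF : Measurable F) :
    Measurable fun y => winUtility κ u C α n y (F y) := by
  have hmeas : Measurable fun z : (Fin N → ℝ) × ℝ => u (profit C α z.2 (F z.1)) :=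
    (measurable_utility_profit hu C α).comp (measurable_snd.prodMk (hF.comp measurable_fst))
  exact (hmeas.stronglyMeasurable.integral_kernel_prod_right' (κ := κ n)).measurable

section ConditionalModel

variable {Ω : Type*} [MeasurableSpace Ω] {P : Measure Ω} {N : ℕ} [NeZero N]
  {X Y : Fin N → Ω → ℝ} {I : Set ℝ} {κ : Fin N → Kernel (Fin N → ℝ) ℝ} {u : ℝ → ℝ}
  {C : Contract} {α : ℝ} {y : Fin N → ℝ}

theorem Model.conditionalModel {f : (Fin N → ℝ) → ℝ} (hM : Model P X Y I f κ u) :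
    ConditionalModel P X Y I κ u where
  measurable_X := hM.measurable_X
  measurable_Y := hM.measurable_Y
  measurableSet_I := hM.interval.measurableSet
  signal_mem := hM.signal_mem
  law_symm := hM.law_symm
  markov := hM.markov
  cond_law := hM.cond_law
  cond_symm := hM.cond_symm
  pos_dep h hh y hy y' hy' hle hint hint' := by
    have hf := hM.measurable_f
    have hpos := hM.density_pos y hy
    have hpos' := hM.density_pos y' hy'
    have hdep := hM.pos_dep h hh y y y' y' hy hy hy' hy' le_rfl le_rfl hle hle
      (boxExpExists_self hf _ hpos hint) (boxExpExists_self hf _ hpos' hint')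
    rw [boxLaw_self hf _ hpos, boxLaw_self hf _ hpos'] at hdep
    exact ⟨hdep.1, fun hlt => hdep.2 (Or.inl hlt)⟩
  concave := hM.concave
  increasing := hM.increasing
  normalized := hM.normalized

theorem ConditionalModel.winUtility_swap (hM : ConditionalModel P X Y I κ u)
    (hy : y ∈ signalSpace N I) (n : Fin N) (b : ℝ) :
    winUtility κ u C α n y b = winUtility κ u C α 0 (y ∘ Equiv.swap 0 n) b := by
  have h := hM.cond_symm (Equiv.swap 0 n) 0 y hy
  rw [Equiv.swap_apply_left] at h
  rw [winUtility, winUtility, h]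

variable (hM : ConditionalModel P X Y I κ u) (hfin : FiniteUtilities P X Y I κ u C α)

include hM hfin

theorem ConditionalModel.winUtility_mono (hα : α < 1) {y' : Fin N → ℝ} (hy : y ∈ signalSpace N I)
    (hy' : y' ∈ signalSpace N I) (hle : y ≤ y') (b : ℝ) :
    winUtility κ u C α 0 y b ≤ winUtility κ u C α 0 y' b ∧
      (y 0 < y' 0 → winUtility κ u C α 0 y b < winUtility κ u C α 0 y' b) :=
  hM.pos_dep _ (hM.increasing.comp (strictMono_profit C hα b)) y hy y' hy' hle
    (hfin.conditional y hy b) (hfin.conditional y' hy' b)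

theorem ConditionalModel.strictAnti_winUtility (hα : α < 1) (hy : y ∈ signalSpace N I) :
    StrictAnti (winUtility κ u C α 0 y) :=
  have := hM.markov 0
  strictAnti_integral_utility hα hM.increasing (hfin.conditional y hy)

theorem ConditionalModel.integrable_utility_finalPrice (hN : 2 ≤ N) {w : (Fin N → ℝ) → ℝ}
    (hw : Measurable w) (hwe : Set.EqOn w (indiffPrice κ u C α) (signalSpace N I)) (n : Fin N) :
    Integrable (fun ω => u (profit C α (X n ω)
      (finalPrice w n (fun i => Y i ω) (topOther n fun i => Y i ω)))) P := by
  have hY : ∀ ω, (fun i => Y i ω) ∈ signalSpace N I := fun ω i => hM.signal_mem i ω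
  have hswap : IdentDistrib (fun ω => (X n ω, fun i => Y (Equiv.swap 0 n i) ω))
      (fun ω => (X 0 ω, fun i => Y i ω)) P P :=
    { aemeasurable_fst := ((hM.measurable_X n).prodMk
        (measurable_pi_lambda _ fun i => hM.measurable_Y _)).aemeasurable
      aemeasurable_snd := ((hM.measurable_X 0).prodMk
        (measurable_pi_lambda _ hM.measurable_Y)).aemeasurable
      map_eq := by simpa using hM.law_symm (Equiv.swap 0 n) 0 }
  have hmeas : Measurable fun z : ℝ × (Fin N → ℝ) =>
      u (profit C α z.1 (finalPrice w 0 z.2 (topOther 0 z.2))) :=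
    (measurable_utility_profit hM.increasing.monotone C α).comp
      (measurable_fst.prodMk ((measurable_finalPrice hw 0).comp measurable_snd))
  have hzero : Integrable (fun ω => u (profit C α (X 0 ω)
      (finalPrice w 0 (fun i => Y i ω) (topOther 0 fun i => Y i ω)))) P := by
    refine hfin.winning.congr (ae_of_all _ fun ω => ?_)
    simp only [finalPrice, Equiv.swap_self, Equiv.coe_refl, Function.comp_id]
    rw [hwe (update_mem_signalSpace (hY ω) 0 (topOther_mem hN 0 (hY ω))), topOther]
  refine ((hswap.comp hmeas).integrable_iff.2 hzero).congr (ae_of_all _ fun ω => ?_)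
  simp only [Function.comp_def, finalPrice, Equiv.swap_self, Equiv.refl_apply]
  rw [← topOther_comp_swap n]
  rfl

theorem ConditionalModel.integrable_stayUtility [SFinite P] (hN : 2 ≤ N) {w : (Fin N → ℝ) → ℝ}
    (hw : Measurable w) (hwe : Set.EqOn w (indiffPrice κ u C α) (signalSpace N I)) (n : Fin N) :
    Integrable (fun ω => stayUtility (winUtility κ u C α) w n fun i => Y i ω) P := by
  have := hM.markov n
  have hu := hM.increasing.monotone
  have hY : Measurable fun ω i => Y i ω := measurable_pi_lambda _ hM.measurable_Y
  have hF := measurable_finalPrice hw n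
  have hstay : Measurable (stayUtility (winUtility κ u C α) w n) := measurable_winUtility n hu hF
  have hmeas : Measurable fun z : (Fin N → ℝ) × ℝ =>
      u (profit C α z.2 (finalPrice w n z.1 (topOther n z.1))) :=
    (measurable_utility_profit hu C α).comp (measurable_snd.prodMk (hF.comp measurable_fst))
  have hjoint := (integrable_map_measure hmeas.aestronglyMeasurable
    (hY.prodMk (hM.measurable_X n)).aemeasurable).2
    (hM.integrable_utility_finalPrice hfin hN hw hwe n)
  rw [hM.cond_law n] at hjoint
  have hsignals : Integrable (stayUtility (winUtility κ u C α) w n) (P.map fun ω i => Y i ω) :=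
    ((Measure.integrable_compProd_iff hmeas.aestronglyMeasurable).1 hjoint).2.mono'
      hstay.aestronglyMeasurable (ae_of_all _ fun y => norm_integral_le_integral_norm _)
  exact (integrable_map_measure hstay.aestronglyMeasurable hY.aemeasurable).1 hsignals

variable (hα0 : 0 ≤ α) (hα1 : α < 1)

include hα0 hα1

theorem ConditionalModel.existsUnique_winUtility_eq_zero (hy : y ∈ signalSpace N I) :
    ∃! b, winUtility κ u C α 0 y b = 0 := by
  have := hM.markov 0
  have hpos : 0 < u 1 := hM.normalized ▸ hM.increasing one_pos
  exact existsUnique_integral_utility_eq_zero hα0 hα1 hM.increasing hM.concave hpos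
    (hfin.conditional y hy)

theorem ConditionalModel.winUtility_indiffPrice (hy : y ∈ signalSpace N I) :
    winUtility κ u C α 0 y (indiffPrice κ u C α y) = 0 :=
  Classical.epsilon_spec (hM.existsUnique_winUtility_eq_zero hfin hα0 hα1 hy).exists

theorem ConditionalModel.indiffPrice_le_iff (hy : y ∈ signalSpace N I) (b : ℝ) :
    indiffPrice κ u C α y ≤ b ↔ winUtility κ u C α 0 y b ≤ 0 := by
  rw [← hM.winUtility_indiffPrice hfin hα0 hα1 hy]
  exact (hM.strictAnti_winUtility hfin hα1 hy).le_iff_ge.symm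

theorem ConditionalModel.le_indiffPrice_iff (hy : y ∈ signalSpace N I) (b : ℝ) :
    b ≤ indiffPrice κ u C α y ↔ 0 ≤ winUtility κ u C α 0 y b := by
  rw [← hM.winUtility_indiffPrice hfin hα0 hα1 hy]
  exact (hM.strictAnti_winUtility hfin hα1 hy).le_iff_ge.symm

theorem ConditionalModel.isPriceRule_indiffPrice :
    IsPriceRule I (indiffPrice κ u C α) (winUtility κ u C α) where
  mono y hy y' hy' hle := by
    rw [hM.le_indiffPrice_iff hfin hα0 hα1 hy', ← hM.winUtility_indiffPrice hfin hα0 hα1 hy]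
    exact (hM.winUtility_mono hfin hα1 hy hy' hle _).1
  strict {y y'} hy hy' hle hlt := by
    rw [← not_le, hM.indiffPrice_le_iff hfin hα0 hα1 hy', not_le,
      ← hM.winUtility_indiffPrice hfin hα0 hα1 hy]
    exact (hM.winUtility_mono hfin hα1 hy hy' hle _).2 hlt
  symm {y} π hy hπ := by
    simp only [indiffPrice, winUtility, ← hM.cond_symm π 0 y hy, hπ]
  nonneg n b hy hb := by
    rwa [hM.winUtility_swap hy, ← hM.le_indiffPrice_iff hfin hα0 hα1 (comp_mem_signalSpace hy _)]
  nonpos n b hy hb := by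
    rwa [hM.winUtility_swap hy, ← hM.indiffPrice_le_iff hfin hα0 hα1 (comp_mem_signalSpace hy _)]

-- Off the signal space `indiffPrice` is an arbitrary choice and need not be measurable.
theorem ConditionalModel.exists_measurable_eqOn_indiffPrice :
    ∃ w : (Fin N → ℝ) → ℝ, Measurable w ∧ Set.EqOn w (indiffPrice κ u C α) (signalSpace N I) := by
  have := hM.markov 0
  have hrestrict : Measurable ((signalSpace N I).domRestrict (indiffPrice κ u C α)) := by
    refine measurable_of_Iic fun b => ?_
    have hpreimage : (signalSpace N I).domRestrict (indiffPrice κ u C α) ⁻¹' Set.Iic b =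
        Subtype.val ⁻¹' {y | winUtility κ u C α 0 y b ≤ 0} :=
      Set.ext fun y => hM.indiffPrice_le_iff hfin hα0 hα1 y.2 b
    rw [hpreimage]
    exact measurable_subtype_coe (measurableSet_le
      (measurable_winUtility 0 hM.increasing.monotone measurable_const) measurable_const)
  obtain ⟨w, hw, hext⟩ := (MeasurableEmbedding.subtype_coe
    (measurableSet_signalSpace hM.measurableSet_I)).exists_measurable_extend hrestrict fun _ => ⟨0⟩
  exact ⟨w, hw, fun y hy => congrFun hext ⟨y, hy⟩⟩

end ConditionalModel

/-! ### Bids and inferred signals -/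

section Stack

variable {N : ℕ} {qs : List ℝ}

theorem stack_apply (N : ℕ) (y : ℝ) (qs : List ℝ) (i : Fin N) :
    stack N y qs i =
      if (i : ℕ) < N - qs.length then y else qs.getD (i - (N - qs.length)) y := by
  unfold stack
  split_ifs with h
  · rw [List.getD_append _ _ _ _ (by simpa using h)]
    simp [h]
  · rw [List.getD_append_right _ _ _ _ (by simpa using h)]
    simp

theorem stack_zero [NeZero N] (y : ℝ) (h : qs.length < N) : stack N y qs 0 = y := by
  rw [stack_apply, if_pos (by simpa using h)]

theorem stack_mem {I : Set ℝ} {y : ℝ} (hy : y ∈ I) (hqs : ∀ x ∈ qs, x ∈ I) :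
    stack N y qs ∈ signalSpace N I := by
  intro i
  rw [stack_apply]
  split_ifs
  · exact hy
  · by_cases hk : (i : ℕ) - (N - qs.length) < qs.length
    · rw [List.getD_eq_getElem _ _ hk]
      exact hqs _ (List.getElem_mem hk)
    · rwa [List.getD_eq_default _ _ (not_lt.1 hk)]

theorem stack_le_stack {y y' : ℝ} (h : qs.length ≤ N) (hy : y ≤ y') :
    stack N y qs ≤ stack N y' qs := by
  intro i
  rw [stack_apply, stack_apply]
  split_ifs
  · exact hy
  · have hk : (i : ℕ) - (N - qs.length) < qs.length := by omega
    rw [List.getD_eq_getElem _ _ hk, List.getD_eq_getElem _ _ hk]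

theorem stack_cons_self (y : ℝ) (h : qs.length < N) : stack N y (y :: qs) = stack N y qs := by
  have hlist : List.replicate (N - (y :: qs).length) y ++ y :: qs
      = List.replicate (N - qs.length) y ++ qs := by
    rw [show N - qs.length = N - (y :: qs).length + 1 by rw [List.length_cons]; omega,
      List.replicate_succ', List.append_assoc, List.singleton_append]
  funext i
  simp only [stack, hlist]

theorem stack_cons_le_stack_cons {y y' a a' : ℝ} (h : qs.length < N) (hy : y ≤ y') (ha : a ≤ a') :
    stack N y (a :: qs) ≤ stack N y' (a' :: qs) := by
  intro i
  simp only [stack_apply, List.length_cons]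
  split_ifs
  · exact hy
  · cases hk : (i : ℕ) - (N - (qs.length + 1)) with
    | zero => simpa using ha
    | succ k =>
      have hk' : k < qs.length := by omega
      rw [List.getD_cons_succ, List.getD_cons_succ, List.getD_eq_getElem _ _ hk',
        List.getD_eq_getElem _ _ hk']

theorem map_stack (y : ℝ) (h : qs.length ≤ N) :
    (Finset.univ : Finset (Fin N)).val.map (stack N y qs)
      = Multiset.replicate (N - qs.length) y + (qs : Multiset ℝ) := by
  have hofFn : List.ofFn (stack N y qs) = List.replicate (N - qs.length) y ++ qs := by
    refine List.ext_getElem (by simp [h]) fun i _ hi => ?_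
    simp only [List.getElem_ofFn, stack]
    rw [List.getD_eq_getElem _ _ hi]
  rw [Fin.univ_val_map, hofFn, ← Multiset.coe_add, Multiset.coe_replicate]

end Stack

section Rearrangement

variable {N : ℕ} {x x' : Fin N → ℝ}

theorem exists_perm_eq_comp_of_map_eq
    (h : (Finset.univ : Finset (Fin N)).val.map x = Finset.univ.val.map x') :
    ∃ π : Equiv.Perm (Fin N), x = x' ∘ π := by
  rw [Fin.univ_val_map, Fin.univ_val_map, Multiset.coe_eq_coe] at h
  have hsort : x ∘ Tuple.sort x = x' ∘ Tuple.sort x' := by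
    apply List.ofFn_injective
    exact ((((Tuple.sort x).ofFn_comp_perm x).trans h).trans
      ((Tuple.sort x').ofFn_comp_perm x').symm).eq_of_pairwise'
      (Tuple.monotone_sort x).sortedLE_ofFn.pairwise (Tuple.monotone_sort x').sortedLE_ofFn.pairwise
  refine ⟨(Tuple.sort x).symm.trans (Tuple.sort x'), funext fun i => ?_⟩
  simpa using congrFun hsort ((Tuple.sort x).symm i)

theorem exists_perm_eq_comp_of_map_eq_of_apply_eq {i₀ : Fin N} (h₀ : x i₀ = x' i₀)
    (h : (Finset.univ : Finset (Fin N)).val.map x = Finset.univ.val.map x') :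
    ∃ π : Equiv.Perm (Fin N), π i₀ = i₀ ∧ x = x' ∘ π := by
  obtain ⟨π, rfl⟩ := exists_perm_eq_comp_of_map_eq h
  refine ⟨π.trans (Equiv.swap (π i₀) i₀), by simp, funext fun i => ?_⟩
  exact (Equiv.apply_swap_eq_self h₀ (π i)).symm

end Rearrangement

theorem length_inferred (q : List ℝ → ℝ) (h : List ℝ) : (inferred q h).length = h.length := by
  induction h with
  | nil => rfl
  | cons p h ih => rw [inferred, List.length_cons, List.length_cons, ih]

theorem IsInference.inferred_mem {N : ℕ} {I : Set ℝ} {w : (Fin N → ℝ) → ℝ} {q : List ℝ → ℝ}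
    (hq : IsInference w I q) (h : List ℝ) : ∀ x ∈ inferred q h, x ∈ I := by
  induction h with
  | nil => simp [inferred]
  | cons p h ih => exact List.forall_mem_cons.2 ⟨hq.mem p h, ih⟩

section Bids

variable {N : ℕ} [NeZero N] {I : Set ℝ} {w : (Fin N → ℝ) → ℝ} {V : Fin N → (Fin N → ℝ) → ℝ → ℝ}
  {q : List ℝ → ℝ} {h : List ℝ}

theorem IsPriceRule.eq_of_map_eq (R : IsPriceRule I w V) {x x' : Fin N → ℝ}
    (hx' : x' ∈ signalSpace N I) (h₀ : x 0 = x' 0)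
    (h : (Finset.univ : Finset (Fin N)).val.map x = Finset.univ.val.map x') : w x = w x' := by
  obtain ⟨π, hπ, rfl⟩ := exists_perm_eq_comp_of_map_eq_of_apply_eq h₀ h
  exact R.symm π hx' hπ

theorem IsPriceRule.strictMonoOn_stack (R : IsPriceRule I w V) {qs : List ℝ} (hl : qs.length < N)
    (hqs : ∀ x ∈ qs, x ∈ I) : StrictMonoOn (fun b => w (stack N b qs)) I := by
  intro b hb c hc hbc
  refine R.strict (stack_mem hb hqs) (stack_mem hc hqs) (stack_le_stack hl.le hbc.le) ?_
  rwa [stack_zero _ hl, stack_zero _ hl]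

theorem strictMonoOn_bid (R : IsPriceRule I w V) (hq : IsInference w I q) (hl : h.length < N) :
    StrictMonoOn (fun y => bid w q y h) I :=
  R.strictMonoOn_stack (by rwa [length_inferred]) (hq.inferred_mem h)

theorem inference_bid_cons (R : IsPriceRule I w V) (hq : IsInference w I q)
    (hl : h.length + 2 ≤ N) {y : ℝ} (hy : y ∈ I) : q (bid w q y h :: h) = y :=
  (strictMonoOn_bid R hq (by omega)).injOn (hq.mem _ _) hy
    (hq.solves (bid w q y h) h hl ⟨y, hy, rfl⟩)

theorem bid_bid_cons (R : IsPriceRule I w V) (hq : IsInference w I q)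
    (hl : h.length + 2 ≤ N) {y : ℝ} (hy : y ∈ I) :
    bid w q y (bid w q y h :: h) = bid w q y h := by
  change w (stack N y (q (bid w q y h :: h) :: inferred q h)) = _
  rw [inference_bid_cons R hq hl hy, stack_cons_self _ (by rw [length_inferred]; omega)]
  rfl

theorem bid_le_bid_bid_cons (R : IsPriceRule I w V) (hq : IsInference w I q)
    (hl : h.length + 2 ≤ N) {y z : ℝ} (hy : y ∈ I) (hz : z ∈ I) (hyz : y ≤ z) :
    bid w q y h ≤ bid w q z (bid w q y h :: h) :=
  calc bid w q y h = bid w q y (bid w q y h :: h) := (bid_bid_cons R hq hl hy).symm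
    _ ≤ bid w q z (bid w q y h :: h) :=
      (strictMonoOn_bid R hq (by rw [List.length_cons]; omega)).monotoneOn hy hz hyz

theorem bid_cons_le_of_forall_bid_le (R : IsPriceRule I w V) (hq : IsInference w I q)
    (hl : h.length < N) {c : ℝ} (hc : ∀ z ∈ I, bid w q z h ≤ c) (p : ℝ) {z : ℝ} (hz : z ∈ I) :
    bid w q z (p :: h) ≤ c := by
  have hl' : (inferred q h).length < N := by rwa [length_inferred]
  have hm : max z (q (p :: h)) ∈ I := max_rec' (· ∈ I) hz (hq.mem p h)
  have hstack : stack N z (inferred q (p :: h)) ≤ stack N (max z (q (p :: h))) (inferred q h) := by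
    rw [← stack_cons_self _ hl']
    exact stack_cons_le_stack_cons hl' (le_max_left _ _) (le_max_right _ _)
  exact (R.mono (stack_mem hz (hq.inferred_mem (p :: h))) (stack_mem hm (hq.inferred_mem h))
    hstack).trans (hc _ hm)

theorem inference_le_inference_cons (R : IsPriceRule I w V) (hq : IsInference w I q) {p p' : ℝ}
    (hl : h.length + 3 ≤ N) (hp : p ≤ p') (hs : ∃ b ∈ I, SignalEq w q h p b)
    (hs' : ∃ b ∈ I, SignalEq w q (p :: h) p' b) : q (p :: h) ≤ q (p' :: p :: h) := by
  have hbid : bid w q (q (p :: h)) h = p := hq.solves p h (by omega) hs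
  have hbid' : bid w q (q (p' :: p :: h)) (p :: h) = p' :=
    hq.solves p' (p :: h) (by rw [List.length_cons]; omega) hs'
  have hagain : bid w q (q (p :: h)) (p :: h) = p := by
    simpa only [hbid] using bid_bid_cons R hq (h := h) (by omega) (hq.mem p h)
  have hmono := strictMonoOn_bid R hq (h := p :: h) (by rw [List.length_cons]; omega)
  exact (hmono.le_iff_le (hq.mem _ _) (hq.mem _ _)).1 ((hagain.trans_le hp).trans hbid'.ge)

end Bids

section FirstOut

variable {N : ℕ} [NeZero N] {ρ : Equiv.Perm (Fin N)} {b : Fin N → ℝ} {D : Finset (Fin N)}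

theorem firstOut_spec (ρ : Equiv.Perm (Fin N)) (b : Fin N → ℝ) (hD : D.Nonempty) :
    firstOut ρ b D ∈ D ∧ ∀ j ∈ D,
      b (firstOut ρ b D) < b j ∨ (b (firstOut ρ b D) = b j ∧ ρ (firstOut ρ b D) ≤ ρ j) := by
  refine Classical.epsilon_spec
    (p := fun i => i ∈ D ∧ ∀ j ∈ D, b i < b j ∨ (b i = b j ∧ ρ i ≤ ρ j)) ?_
  obtain ⟨i, hi, hmin⟩ := D.exists_min_image (fun i => toLex (b i, ρ i)) hD
  exact ⟨i, hi, fun j hj => Prod.Lex.toLex_le_toLex.1 (hmin j hj)⟩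

theorem firstOut_mem (ρ : Equiv.Perm (Fin N)) (b : Fin N → ℝ) (hD : D.Nonempty) :
    firstOut ρ b D ∈ D := (firstOut_spec ρ b hD).1

theorem firstOut_le (ρ : Equiv.Perm (Fin N)) (b : Fin N → ℝ) {j : Fin N} (hj : j ∈ D) :
    b (firstOut ρ b D) ≤ b j :=
  ((firstOut_spec ρ b ⟨j, hj⟩).2 j hj).elim le_of_lt fun h => h.1.le

theorem firstOut_eq {i : Fin N} (hi : i ∈ D)
    (hmin : ∀ j ∈ D, b i < b j ∨ (b i = b j ∧ ρ i ≤ ρ j)) : firstOut ρ b D = i := by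
  obtain ⟨hmem, hfirst⟩ := firstOut_spec ρ b ⟨i, hi⟩
  have hle : toLex (b i, ρ i) ≤ toLex (b (firstOut ρ b D), ρ (firstOut ρ b D)) :=
    Prod.Lex.toLex_le_toLex.2 (hmin _ hmem)
  have hge : toLex (b (firstOut ρ b D), ρ (firstOut ρ b D)) ≤ toLex (b i, ρ i) :=
    Prod.Lex.toLex_le_toLex.2 (hfirst i hi)
  exact ρ.injective (congrArg (fun z => (ofLex z).2) (le_antisymm hge hle))

theorem firstOut_congr {b' : Fin N → ℝ} (hD : D.Nonempty)
    (h : ∀ i ∈ D, ∀ j ∈ D, b i ≤ b j ↔ b' i ≤ b' j) : firstOut ρ b D = firstOut ρ b' D := by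
  obtain ⟨hmem, hfirst⟩ := firstOut_spec ρ b' hD
  refine firstOut_eq hmem fun j hj => ?_
  have hle := h _ hmem j hj
  have hge := h j hj _ hmem
  rcases hfirst j hj with hlt | ⟨heq, hρ⟩
  · exact Or.inl (lt_iff_lt_of_le_iff_le hge |>.2 hlt)
  · exact Or.inr ⟨le_antisymm (hle.2 heq.le) (hge.2 heq.ge), hρ⟩

theorem play_fst_mem (ρ : Equiv.Perm (Fin N)) (σ : Fin N → Strategy) (y : Fin N → ℝ) (k : ℕ)
    (h : List ℝ) (c : EReal) {S : Finset (Fin N)} (hS : S.card = k + 1) :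
    (play ρ σ y k h c S).1 ∈ S := by
  induction k generalizing h c S with
  | zero => exact Classical.epsilon_spec (p := fun i => i ∈ S) (Finset.card_pos.1 (by omega))
  | succ k ih =>
    have hi := firstOut_mem ρ (exitPrice σ y h c) (D := S) (Finset.card_pos.1 (by omega))
    exact Finset.mem_of_mem_erase (ih _ _ (by rw [Finset.card_erase_of_mem hi, hS]; rfl))

theorem firstOut_ne_play_fst (σ : Fin N → Strategy) (y : Fin N → ℝ) {k : ℕ} (h : List ℝ)
    (c : EReal) {S : Finset (Fin N)} (hS : S.card = k + 2) :
    firstOut ρ (exitPrice σ y h c) S ≠ (play ρ σ y (k + 1) h c S).1 := by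
  have hi := firstOut_mem ρ (exitPrice σ y h c) (D := S) (Finset.card_pos.1 (by omega))
  exact (Finset.ne_of_mem_erase (play_fst_mem ρ σ y k _ _
    (by rw [Finset.card_erase_of_mem hi, hS]; rfl))).symm

end FirstOut

/-! ### Consistent nodes -/

section ExitPrice

variable {N : ℕ} {σ : Fin N → Strategy} {y : Fin N → ℝ} {h : List ℝ} {c : EReal} {i : Fin N}

theorem coe_exitPrice (hc : c < ⊤) :
    (exitPrice σ y h c i : EReal) = max c (σ i (y i) h : ℝ) :=
  EReal.coe_toReal (max_lt hc (EReal.coe_lt_top _)).ne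
    (ne_bot_of_le_ne_bot (EReal.coe_ne_bot _) (le_max_right _ _))

theorem exitPrice_of_clock_le (hle : c ≤ (σ i (y i) h : ℝ)) :
    exitPrice σ y h c i = σ i (y i) h := by
  rw [exitPrice, max_eq_right hle, EReal.toReal_coe]

theorem exitPrice_of_le_clock {c : ℝ} (hle : σ i (y i) h ≤ c) :
    exitPrice σ y h (c : EReal) i = c := by
  rw [exitPrice, max_eq_left (EReal.coe_le_coe_iff.2 hle), EReal.toReal_coe]

theorem le_exitPrice {c : ℝ} (σ : Fin N → Strategy) (y : Fin N → ℝ) (h : List ℝ) (i : Fin N) :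
    c ≤ exitPrice σ y h (c : EReal) i := by
  rw [← EReal.coe_le_coe_iff, coe_exitPrice (EReal.coe_lt_top c)]
  exact le_max_left _ _

theorem exitPrice_lt {b : ℝ} (hc : c < (b : EReal)) (hs : σ i (y i) h < b) :
    exitPrice σ y h c i < b := by
  rw [← EReal.coe_lt_coe_iff, coe_exitPrice (hc.trans (EReal.coe_lt_top b))]
  exact max_lt hc (EReal.coe_lt_coe_iff.2 hs)

end ExitPrice

theorem play_succ {N : ℕ} [NeZero N] {ρ : Equiv.Perm (Fin N)} {σ : Fin N → Strategy}
    {y : Fin N → ℝ} {h : List ℝ} {c : EReal} {S : Finset (Fin N)} (k : ℕ) {i : Fin N} {p : ℝ}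
    (hi : firstOut ρ (exitPrice σ y h c) S = i) (hp : exitPrice σ y h c i = p) :
    play ρ σ y (k + 1) h c S = play ρ σ y k (p :: h) (p : EReal) (S.erase i) := by
  subst hi hp
  rfl

/-- The node `(y, S)` is consistent, for buyer `n`, with the drop-out prices `h` and the clock price
`c`: the signals inferred from `h` are the true ones of the buyers who have left, and no other
active buyer should have left before `c`. -/
structure IsConsistent {N : ℕ} (w : (Fin N → ℝ) → ℝ) (I : Set ℝ) (q : List ℝ → ℝ) (n : Fin N)
    (y : Fin N → ℝ) (S : Finset (Fin N)) (h : List ℝ) (c : EReal) : Prop where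
  mem : y ∈ signalSpace N I
  active : n ∈ S
  card : S.card + h.length = N
  dropped : (Finset.univ \ S).val.map y = (inferred q h : Multiset ℝ)
  le_bid : ∀ j ∈ S, j ≠ n → c ≤ (bid w q (y j) h : ℝ)

section Consistent

variable {N : ℕ} {I : Set ℝ} {w : (Fin N → ℝ) → ℝ} {q : List ℝ → ℝ} {n : Fin N} {y : Fin N → ℝ}
  {S : Finset (Fin N)} {h : List ℝ} {c : EReal} {σ : Fin N → Strategy} {i : Fin N}

theorem IsConsistent.exitPrice_eq_bid (hc : IsConsistent w I q n y S h c)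
    (hσ : ∀ j ≠ n, σ j = bid w q) (hi : i ∈ S) (hin : i ≠ n) :
    exitPrice σ y h c i = bid w q (y i) h := by
  rw [exitPrice_of_clock_le (by rw [hσ i hin]; exact hc.le_bid i hi hin), hσ i hin]

theorem IsConsistent.length_add_two_le (hc : IsConsistent w I q n y S h c) (hi : i ∈ S)
    (hin : i ≠ n) : h.length + 2 ≤ N := by
  have hcard : 1 < S.card := Finset.one_lt_card.2 ⟨i, hi, n, hc.active, hin⟩
  have hN := hc.card
  omega

theorem IsConsistent.nonempty_erase (hc : IsConsistent w I q n y S h c) (hl : h.length + 2 ≤ N) :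
    (S.erase n).Nonempty := by
  have hcard := hc.card
  refine Finset.card_pos.1 ?_
  rw [Finset.card_erase_of_mem hc.active]
  omega

theorem map_update_univ_of_eq_pair (hin : i ≠ n) (hS : S = {n, i}) :
    (Finset.univ : Finset (Fin N)).val.map (Function.update y n (y i))
      = Multiset.replicate 2 (y i) + (Finset.univ \ S).val.map y := by
  have huniv : (Finset.univ : Finset (Fin N)) = insert n (insert i (Finset.univ \ S)) := by
    ext j
    simp only [hS, Finset.mem_univ, Finset.mem_insert, Finset.mem_sdiff, Finset.mem_singleton,
      true_and, true_iff]
    tauto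
  have hagree : (Finset.univ \ S).val.map (Function.update y n (y i))
      = (Finset.univ \ S).val.map y := by
    refine Multiset.map_congr rfl fun j hj => Function.update_of_ne ?_ _ _
    rintro rfl
    exact (Finset.mem_sdiff.1 hj).2 (by simp [hS])
  conv_lhs => rw [huniv]
  rw [Finset.insert_val_of_notMem (by simp [hS, hin.symm]),
    Finset.insert_val_of_notMem (by simp [hS]), Multiset.map_cons, Multiset.map_cons,
    Function.update_self, Function.update_of_ne hin, hagree, Multiset.replicate_succ,
    Multiset.replicate_one, Multiset.cons_add, Multiset.singleton_add]

variable [NeZero N] {V : Fin N → (Fin N → ℝ) → ℝ → ℝ} {ρ : Equiv.Perm (Fin N)}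

theorem IsConsistent.erase (R : IsPriceRule I w V) (hq : IsInference w I q)
    (hc : IsConsistent w I q n y S h c) (hi : i ∈ S) (hin : i ≠ n)
    (hmin : ∀ j ∈ S, j ≠ n → y i ≤ y j) :
    IsConsistent w I q n y (S.erase i) (bid w q (y i) h :: h) (bid w q (y i) h : ℝ) where
  mem := hc.mem
  active := Finset.mem_erase.2 ⟨hin.symm, hc.active⟩
  card := by
    have hcard := Finset.card_erase_add_one hi
    have hN := hc.card
    rw [List.length_cons]
    omega
  dropped := by
    have hl := hc.length_add_two_le hi hin
    rw [Finset.sdiff_erase (Finset.mem_univ i), Finset.insert_val_of_notMem (by simp [hi]),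
      Multiset.map_cons, hc.dropped, inferred, inference_bid_cons R hq hl (hc.mem i),
      Multiset.cons_coe]
  le_bid j hj hjn := EReal.coe_le_coe_iff.2 <|
    bid_le_bid_bid_cons R hq (hc.length_add_two_le hi hin) (hc.mem i) (hc.mem j)
      (hmin j (Finset.mem_of_mem_erase hj) hjn)

theorem IsConsistent.of_firstOut_ne (R : IsPriceRule I w V) (hq : IsInference w I q)
    (hc : IsConsistent w I q n y S h c) (hσ : ∀ j ≠ n, σ j = bid w q)
    (hi : firstOut ρ (exitPrice σ y h c) S = i) (hin : i ≠ n) :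
    i ∈ S ∧ ∀ j ∈ S, j ≠ n → y i ≤ y j := by
  have hiS : i ∈ S := hi ▸ firstOut_mem ρ _ ⟨n, hc.active⟩
  refine ⟨hiS, fun j hj hjn => ?_⟩
  have hfirst := firstOut_le ρ (exitPrice σ y h c) hj
  rw [hi, hc.exitPrice_eq_bid hσ hiS hin, hc.exitPrice_eq_bid hσ hj hjn] at hfirst
  have hl := hc.length_add_two_le hiS hin
  exact ((strictMonoOn_bid R hq (by omega)).le_iff_le (hc.mem i) (hc.mem j)).1 hfirst

theorem IsConsistent.bid_eq_finalPrice (R : IsPriceRule I w V)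
    (hc : IsConsistent w I q n y S h c) (hin : i ≠ n) (hS : S = {n, i}) :
    bid w q (y i) h = finalPrice w n y (y i) := by
  have hcard : S.card = 2 := by rw [hS, Finset.card_pair hin.symm]
  have hN := hc.card
  have hx : finalPrice w n y (y i) = w (Function.update y n (y i) ∘ Equiv.swap 0 n) := by
    rw [Function.update_comp_equiv, Equiv.symm_swap, Equiv.swap_apply_right, finalPrice]
  rw [hx]
  refine R.eq_of_map_eq (comp_mem_signalSpace (update_mem_signalSpace hc.mem n (hc.mem i)) _) ?_ ?_
  · rw [stack_zero _ (by rw [length_inferred]; omega), Function.comp_apply, Equiv.swap_apply_left,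
      Function.update_self]
  · rw [map_stack _ (by rw [length_inferred]; omega), ← Multiset.map_map,
      Multiset.map_univ_val_equiv, map_update_univ_of_eq_pair hin hS, hc.dropped,
      show N - (inferred q h).length = 2 by rw [length_inferred]; omega]

/-- The last bid reveals the signal of the last of the others to leave. -/
theorem IsConsistent.exists_play_snd_eq (R : IsPriceRule I w V) (hq : IsInference w I q)
    (hσ : ∀ j ≠ n, σ j = bid w q) (k : ℕ) (hc : IsConsistent w I q n y S h c)
    (hS : S.card = k + 2) (hwin : (play ρ σ y (k + 1) h c S).1 = n) :
    ∃ i ∈ S, i ≠ n ∧ (∀ j ∈ S, j ≠ n → y j ≤ y i) ∧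
      (play ρ σ y (k + 1) h c S).2 = finalPrice w n y (y i) := by
  induction k generalizing S h c with
  | zero =>
    have hin := (firstOut_ne_play_fst (ρ := ρ) σ y h c hS).trans_eq hwin
    obtain ⟨hi, -⟩ := hc.of_firstOut_ne R hq hσ rfl hin
    set i := firstOut ρ (exitPrice σ y h c) S with hfirst
    have hpair : {n, i} = S := by
      refine Finset.eq_of_subset_of_card_le ?_ (by rw [hS, Finset.card_pair hin.symm])
      simp [Finset.insert_subset_iff, hi, hc.active]
    refine ⟨i, hi, hin, fun j hj hjn => ?_, ?_⟩
    · rw [← hpair, Finset.mem_insert, Finset.mem_singleton] at hj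
      rw [hj.resolve_left hjn]
    · rw [play_succ 0 hfirst.symm (hc.exitPrice_eq_bid hσ hi hin), play,
        EReal.toReal_coe, hc.bid_eq_finalPrice R hin hpair.symm]
  | succ k ih =>
    have hin := (firstOut_ne_play_fst (ρ := ρ) σ y h c hS).trans_eq hwin
    obtain ⟨hi, hmin⟩ := hc.of_firstOut_ne R hq hσ rfl hin
    set i := firstOut ρ (exitPrice σ y h c) S with hfirst
    rw [play_succ (k + 1) hfirst.symm (hc.exitPrice_eq_bid hσ hi hin)] at hwin ⊢
    obtain ⟨l, hl, hln, hmax, hprice⟩ := ih (hc.erase R hq hi hin hmin)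
      (by rw [Finset.card_erase_of_mem hi, hS]; rfl) hwin
    refine ⟨l, Finset.mem_of_mem_erase hl, hln, fun j hj hjn => ?_, hprice⟩
    rcases eq_or_ne j i with rfl | hji
    · exact hmin l (Finset.mem_of_mem_erase hl) hln
    · exact hmax j (Finset.mem_erase.2 ⟨hji, hj⟩) hjn

theorem IsConsistent.firstOut_ne_of_forall_lt (R : IsPriceRule I w V) (hq : IsInference w I q)
    (hc : IsConsistent w I q n y S h c) (hS : 1 < S.card) (hlt : ∀ j ∈ S, j ≠ n → y j < y n) :
    firstOut ρ (exitPrice (fun _ => bid w q) y h c) S ≠ n := by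
  intro hn
  obtain ⟨j, hj, hjn⟩ := Finset.exists_mem_ne hS n
  have hl := hc.length_add_two_le hj hjn
  have hbid : bid w q (y j) h < bid w q (y n) h :=
    strictMonoOn_bid R hq (by omega) (hc.mem j) (hc.mem n) (hlt j hj hjn)
  have hfirst := firstOut_le ρ (exitPrice (fun _ => bid w q) y h c) hj
  rw [hn, hc.exitPrice_eq_bid (fun _ _ => rfl) hj hjn, exitPrice_of_clock_le
    ((hc.le_bid j hj hjn).trans (EReal.coe_le_coe_iff.2 hbid.le))] at hfirst
  exact hbid.not_ge hfirst

theorem IsConsistent.play_fst_eq_of_forall_lt (R : IsPriceRule I w V) (hq : IsInference w I q)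
    (k : ℕ) (hc : IsConsistent w I q n y S h c) (hS : S.card = k + 1)
    (hlt : ∀ j ∈ S, j ≠ n → y j < y n) : (play ρ (fun _ => bid w q) y k h c S).1 = n := by
  induction k generalizing S h c with
  | zero =>
    obtain ⟨a, rfl⟩ := Finset.card_eq_one.1 hS
    rw [Finset.mem_singleton.1 hc.active]
    exact Finset.mem_singleton.1 (play_fst_mem ρ _ y 0 h c hS)
  | succ k ih =>
    have hin := hc.firstOut_ne_of_forall_lt (ρ := ρ) R hq (by omega) hlt
    obtain ⟨hi, hmin⟩ := hc.of_firstOut_ne R hq (fun _ _ => rfl) rfl hin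
    rw [play_succ k rfl (hc.exitPrice_eq_bid (fun _ _ => rfl) hi hin)]
    exact ih (hc.erase R hq hi hin hmin) (by rw [Finset.card_erase_of_mem hi, hS]; rfl)
      fun j hj hjn => hlt j (Finset.mem_of_mem_erase hj) hjn

theorem IsConsistent.firstOut_signal_le (R : IsPriceRule I w V) (hq : IsInference w I q)
    (hc : IsConsistent w I q n y S h c)
    (hclock : c ≤ (bid w q (y n) h : ℝ) ∨ ∀ j ∈ S, j ≠ n → c < (bid w q (y j) h : ℝ))
    (hi : firstOut ρ (exitPrice (fun _ => bid w q) y h c) S = i) (hin : i ≠ n) : y i ≤ y n := by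
  obtain ⟨hiS, -⟩ := hc.of_firstOut_ne R hq (fun _ _ => rfl) hi hin
  have hl := hc.length_add_two_le hiS hin
  by_contra! hlt
  have hbid : bid w q (y n) h < bid w q (y i) h :=
    strictMonoOn_bid R hq (by omega) (hc.mem n) (hc.mem i) hlt
  have hlt_clock : c < (bid w q (y i) h : ℝ) :=
    hclock.elim (fun hle => hle.trans_lt (EReal.coe_lt_coe_iff.2 hbid)) fun hall => hall i hiS hin
  have hfirst := firstOut_le ρ (exitPrice (fun _ => bid w q) y h c) hc.active
  rw [hi, hc.exitPrice_eq_bid (fun _ _ => rfl) hiS hin] at hfirst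
  exact (exitPrice_lt (σ := fun _ => bid w q) hlt_clock hbid).not_ge hfirst

theorem IsConsistent.le_of_play_fst_eq (R : IsPriceRule I w V) (hq : IsInference w I q) (k : ℕ)
    (hc : IsConsistent w I q n y S h c) (hS : S.card = k + 1)
    (hclock : c ≤ (bid w q (y n) h : ℝ) ∨ ∀ j ∈ S, j ≠ n → c < (bid w q (y j) h : ℝ))
    (hwin : (play ρ (fun _ => bid w q) y k h c S).1 = n) {j : Fin N} (hj : j ∈ S) : y j ≤ y n := by
  induction k generalizing S h c with
  | zero => rw [Finset.card_le_one.1 hS.le j hj n hc.active]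
  | succ k ih =>
    have hin := (firstOut_ne_play_fst (ρ := ρ) _ y h c hS).trans_eq hwin
    obtain ⟨hi, hmin⟩ := hc.of_firstOut_ne R hq (fun _ _ => rfl) rfl hin
    have hyi := hc.firstOut_signal_le R hq hclock rfl hin
    set i := firstOut ρ (exitPrice (fun _ => bid w q) y h c) S with hfirst
    rw [play_succ k hfirst.symm (hc.exitPrice_eq_bid (fun _ _ => rfl) hi hin)] at hwin
    rcases eq_or_ne j i with rfl | hji
    · exact hyi
    · exact ih (hc.erase R hq hi hin hmin) (by rw [Finset.card_erase_of_mem hi, hS]; rfl)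
        (Or.inl (EReal.coe_le_coe_iff.2 (bid_le_bid_bid_cons R hq (hc.length_add_two_le hi hin)
          (hc.mem i) (hc.mem n) hyi))) hwin (Finset.mem_erase.2 ⟨hji, hj⟩)

theorem IsConsistent.nodePayoff_eq (R : IsPriceRule I w V) (hq : IsInference w I q)
    (hσ : ∀ j ≠ n, σ j = bid w q) (hc : IsConsistent w I q n y S h c) (hi : i ∈ S) (hin : i ≠ n)
    (hmax : ∀ j ∈ S, j ≠ n → y j ≤ y i) :
    nodePayoff V ρ σ n h c (y, S)
      = if (play ρ σ y (S.card - 1) h c S).1 = n then V n y (finalPrice w n y (y i)) else 0 := by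
  have hcard : 1 < S.card := Finset.one_lt_card.2 ⟨i, hi, n, hc.active, hin⟩
  obtain ⟨k, hk⟩ : ∃ k, S.card = k + 2 := ⟨S.card - 2, by omega⟩
  simp only [nodePayoff, show S.card - 1 = k + 1 by omega]
  split_ifs with hwin
  · obtain ⟨l, hl, hln, hmaxl, hprice⟩ := hc.exists_play_snd_eq R hq hσ k hk hwin
    rw [hprice, le_antisymm (hmax l hl hln) (hmaxl i hi hin)]
  · rfl

theorem IsPriceRule.utility_finalPrice_nonneg (R : IsPriceRule I w V) (hy : y ∈ signalSpace N I)
    {m : ℝ} (hm : m ∈ I) (hle : m ≤ y n) : 0 ≤ V n y (finalPrice w n y m) := by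
  have hy' := comp_mem_signalSpace hy (Equiv.swap 0 n)
  refine R.nonneg n hy (R.mono (update_mem_signalSpace hy' 0 hm) hy' ?_)
  exact update_le_self_iff.2 (by simpa using hle)

theorem IsPriceRule.utility_finalPrice_nonpos (R : IsPriceRule I w V) (hy : y ∈ signalSpace N I)
    {m : ℝ} (hm : m ∈ I) (hle : y n ≤ m) : V n y (finalPrice w n y m) ≤ 0 := by
  have hy' := comp_mem_signalSpace hy (Equiv.swap 0 n)
  refine R.nonpos n hy (R.mono hy' (update_mem_signalSpace hy' 0 hm) ?_)
  exact le_update_self_iff.2 (by simpa using hle)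

theorem IsConsistent.nodePayoff_bid (R : IsPriceRule I w V) (hq : IsInference w I q)
    (hc : IsConsistent w I q n y S h c) (hi : i ∈ S) (hin : i ≠ n)
    (hmax : ∀ j ∈ S, j ≠ n → y j ≤ y i)
    (hclock : c ≤ (bid w q (y n) h : ℝ) ∨ ∀ j ∈ S, j ≠ n → c < (bid w q (y j) h : ℝ)) :
    nodePayoff V ρ (fun _ => bid w q) n h c (y, S) = max (V n y (finalPrice w n y (y i))) 0 := by
  rw [hc.nodePayoff_eq R hq (fun _ _ => rfl) hi hin hmax]
  have hS : S.card = S.card - 1 + 1 := (Nat.sub_add_cancel (Finset.card_pos.2 ⟨i, hi⟩)).symm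
  split_ifs with hwin
  · exact (max_eq_left (R.utility_finalPrice_nonneg hc.mem (hc.mem i)
      (hc.le_of_play_fst_eq R hq _ hS hclock hwin hi))).symm
  · have hle : y n ≤ y i := not_lt.1 fun hlt => hwin <| hc.play_fst_eq_of_forall_lt R hq _ hS
      fun j hj hjn => (hmax j hj hjn).trans_lt hlt
    exact (max_eq_right (R.utility_finalPrice_nonpos hc.mem (hc.mem i) hle)).symm

theorem IsConsistent.nodePayoff_le (R : IsPriceRule I w V) (hq : IsInference w I q)
    (hσ : ∀ j ≠ n, σ j = bid w q) (hc : IsConsistent w I q n y S h c) (hS : 2 ≤ S.card)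
    (hclock : c ≤ (bid w q (y n) h : ℝ) ∨ ∀ j ∈ S, j ≠ n → c < (bid w q (y j) h : ℝ)) :
    nodePayoff V ρ σ n h c (y, S) ≤ nodePayoff V ρ (fun _ => bid w q) n h c (y, S) := by
  have hcard := hc.card
  obtain ⟨i, hi, hmax⟩ := (S.erase n).exists_max_image y (hc.nonempty_erase (by omega))
  obtain ⟨hin, hi⟩ := Finset.mem_erase.1 hi
  have hmax' : ∀ j ∈ S, j ≠ n → y j ≤ y i := fun j hj hjn => hmax j (Finset.mem_erase.2 ⟨hjn, hj⟩)
  rw [hc.nodePayoff_bid R hq hi hin hmax' hclock, hc.nodePayoff_eq R hq hσ hi hin hmax']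
  split_ifs
  exacts [le_max_left _ _, le_max_right _ _]

end Consistent

section ClockBeyondBids

variable {N : ℕ} {I : Set ℝ} {w : (Fin N → ℝ) → ℝ} {q : List ℝ → ℝ} {n i : Fin N} {y : Fin N → ℝ}
  {h : List ℝ} {c : ℝ} {σ : Fin N → Strategy}

theorem exitPrice_eq_clock_of_forall_bid_le (hσ : ∀ j ≠ n, σ j = bid w q)
    (hy : y ∈ signalSpace N I) (hle : ∀ z ∈ I, bid w q z h ≤ c) (hin : i ≠ n) :
    exitPrice σ y h (c : EReal) i = c :=
  exitPrice_of_le_clock (by rw [hσ i hin]; exact hle _ (hy i))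

variable [NeZero N] {V : Fin N → (Fin N → ℝ) → ℝ → ℝ} {ρ : Equiv.Perm (Fin N)}
  {S : Finset (Fin N)}

theorem play_snd_eq_clock_of_forall_bid_le (R : IsPriceRule I w V) (hq : IsInference w I q)
    (hσ : ∀ j ≠ n, σ j = bid w q) (hy : y ∈ signalSpace N I) (k : ℕ) (hn : n ∈ S)
    (hS : S.card = k + 1) (hcard : S.card + h.length = N) (hle : ∀ z ∈ I, bid w q z h ≤ c)
    (hwin : (play ρ σ y k h c S).1 = n) : (play ρ σ y k h c S).2 = c := by
  induction k generalizing S h with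
  | zero => rw [play, EReal.toReal_coe]
  | succ k ih =>
    have hin := (firstOut_ne_play_fst (ρ := ρ) σ y h c hS).trans_eq hwin
    have hi := firstOut_mem ρ (exitPrice σ y h c) ⟨n, hn⟩
    rw [play_succ k rfl (exitPrice_eq_clock_of_forall_bid_le hσ hy hle hin)] at hwin ⊢
    exact ih (Finset.mem_erase.2 ⟨hin.symm, hn⟩) (by rw [Finset.card_erase_of_mem hi, hS]; rfl)
      (by rw [Finset.card_erase_of_mem hi, List.length_cons]; omega)
      (fun z hz => bid_cons_le_of_forall_bid_le R hq (by omega) hle c hz) hwin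

theorem firstOut_eq_of_forall_bid_le (hσ : ∀ j ≠ n, σ j = bid w q) (hy : y ∈ signalSpace N I)
    (hn : n ∈ S) (hle : ∀ z ∈ I, bid w q z h ≤ c)
    (hi : firstOut ρ (exitPrice (fun _ => bid w q) y h c) S = i) (hin : i ≠ n) :
    firstOut ρ (exitPrice σ y h c) S = i := by
  have hclock : ∀ j, exitPrice (fun _ => bid w q) y h (c : EReal) j = c := fun j =>
    exitPrice_of_le_clock (hle _ (hy j))
  obtain ⟨hiS, hmin⟩ := firstOut_spec ρ (exitPrice (fun _ => bid w q) y h c) ⟨n, hn⟩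
  simp only [hi, hclock, lt_irrefl, true_and, false_or] at hiS hmin
  refine firstOut_eq hiS fun j hj => ?_
  rw [exitPrice_eq_clock_of_forall_bid_le hσ hy hle hin]
  exact (le_exitPrice σ y h j).lt_or_eq.imp_right fun heq => ⟨heq, hmin j hj⟩

theorem play_fst_eq_of_forall_bid_le (R : IsPriceRule I w V) (hq : IsInference w I q)
    (hσ : ∀ j ≠ n, σ j = bid w q) (hy : y ∈ signalSpace N I) (k : ℕ) (hn : n ∈ S)
    (hS : S.card = k + 1) (hcard : S.card + h.length = N) (hle : ∀ z ∈ I, bid w q z h ≤ c)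
    (hwin : (play ρ (fun _ => bid w q) y k h c S).1 = n) : (play ρ σ y k h c S).1 = n := by
  induction k generalizing S h with
  | zero => exact hwin
  | succ k ih =>
    have hin := (firstOut_ne_play_fst (ρ := ρ) _ y h c hS).trans_eq hwin
    have hi := firstOut_mem ρ (exitPrice (fun _ => bid w q) y h c) ⟨n, hn⟩
    rw [play_succ k rfl
      (exitPrice_eq_clock_of_forall_bid_le (fun _ _ => rfl) hy hle hin)] at hwin
    rw [play_succ k (firstOut_eq_of_forall_bid_le hσ hy hn hle rfl hin)
      (exitPrice_eq_clock_of_forall_bid_le hσ hy hle hin)]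
    exact ih (Finset.mem_erase.2 ⟨hin.symm, hn⟩) (by rw [Finset.card_erase_of_mem hi, hS]; rfl)
      (by rw [Finset.card_erase_of_mem hi, List.length_cons]; omega)
      (fun z hz => bid_cons_le_of_forall_bid_le R hq (by omega) hle c hz) hwin

theorem nodePayoff_le_of_forall_bid_le (R : IsPriceRule I w V) (hq : IsInference w I q)
    (hσ : ∀ j ≠ n, σ j = bid w q) (hy : y ∈ signalSpace N I) (hn : n ∈ S)
    (hcard : S.card + h.length = N) (hle : ∀ z ∈ I, bid w q z h ≤ c) (hV : V n y c ≤ 0) :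
    nodePayoff V ρ σ n h c (y, S) ≤ nodePayoff V ρ (fun _ => bid w q) n h c (y, S) := by
  have hS : S.card = S.card - 1 + 1 := (Nat.sub_add_cancel (Finset.card_pos.2 ⟨n, hn⟩)).symm
  have hprice {σ' : Fin N → Strategy} (hσ' : ∀ j ≠ n, σ' j = bid w q) :=
    play_snd_eq_clock_of_forall_bid_le (ρ := ρ) R hq hσ' hy _ hn hS hcard hle
  have hwins := play_fst_eq_of_forall_bid_le (ρ := ρ) R hq hσ hy _ hn hS hcard hle
  simp only [nodePayoff]
  split_ifs with hwin hwin' hwin'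
  · rw [hprice hσ hwin, hprice (fun _ _ => rfl) hwin']
  · rwa [hprice hσ hwin]
  · exact absurd (hwins hwin') hwin
  · exact le_rfl

end ClockBeyondBids

/-! ### Nodes on and off the path -/

section PointNode

variable {N : ℕ} {qs : List ℝ}

theorem map_filter_stack (z : ℝ) (qs : List ℝ) :
    (Finset.univ.filter fun i : Fin N => (i : ℕ) < N - qs.length).val.map (stack N z qs)
      = Multiset.replicate (N - qs.length) z := by
  rw [Multiset.eq_replicate]
  refine ⟨?_, fun b hb => ?_⟩
  · rw [Multiset.card_map, Finset.card_val, Fin.card_filter_val_lt, min_eq_right (Nat.sub_le _ _)]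
  · obtain ⟨i, hi, rfl⟩ := Multiset.mem_map.1 hb
    rw [Finset.mem_val, Finset.mem_filter] at hi
    rw [stack_apply, if_pos hi.2]

theorem map_sdiff_filter_stack (z : ℝ) (hl : qs.length ≤ N) :
    (Finset.univ \ Finset.univ.filter fun i : Fin N => (i : ℕ) < N - qs.length).val.map
      (stack N z qs) = (qs : Multiset ℝ) := by
  have hmap := map_stack z hl
  rw [← add_tsub_cancel_of_le (Finset.val_le_iff.2 (Finset.filter_subset
    (fun i : Fin N => (i : ℕ) < N - qs.length) Finset.univ)), Multiset.map_add,
    map_filter_stack, ← Finset.sdiff_val] at hmap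
  exact add_left_cancel hmap

variable [NeZero N]

/-- The node at which buyer `n` has the signal `a`, the other active buyers all have the signal
`z`, and the signals of those who have left are `qs`. It supports the beliefs at the information
sets that Bayes' rule does not reach. -/
def pointNode (n : Fin N) (a z : ℝ) (qs : List ℝ) : Node N :=
  (Function.update (stack N z qs) 0 a ∘ Equiv.swap 0 n,
    (Finset.univ.filter fun i : Fin N => (i : ℕ) < N - qs.length).map (Equiv.swap 0 n).toEmbedding)

variable {I : Set ℝ} {n j : Fin N} {a z : ℝ}

theorem pointNode_fst_self : (pointNode n a z qs).1 n = a := by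
  simp [pointNode]

theorem pointNode_fst_mem (ha : a ∈ I) (hz : z ∈ I) (hqs : ∀ x ∈ qs, x ∈ I) :
    (pointNode n a z qs).1 ∈ signalSpace N I :=
  comp_mem_signalSpace (update_mem_signalSpace (stack_mem hz hqs) 0 ha) _

theorem pointNode_fst_comp_swap (hl : qs.length < N) :
    (pointNode n a a qs).1 ∘ Equiv.swap 0 n = stack N a qs := by
  funext i
  have hstack : Function.update (stack N a qs) 0 a = stack N a qs := by
    rw [Function.update_eq_self_iff, stack_zero a hl]
  simp [pointNode, hstack]

theorem card_pointNode_snd (hl : qs.length ≤ N) :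
    (pointNode n a z qs).2.card + qs.length = N := by
  rw [pointNode, Finset.card_map, Fin.card_filter_val_lt, min_eq_right (Nat.sub_le _ _),
    Nat.sub_add_cancel hl]

theorem mem_pointNode_snd (hl : qs.length < N) : n ∈ (pointNode n a z qs).2 := by
  simp only [pointNode, Finset.mem_map_equiv, Equiv.symm_swap, Equiv.swap_apply_right,
    Finset.mem_filter, Finset.mem_univ, true_and, Fin.val_zero]
  omega

theorem pointNode_fst_of_ne (hj : j ∈ (pointNode n a z qs).2) (hjn : j ≠ n) :
    (pointNode n a z qs).1 j = z := by
  simp only [pointNode, Finset.mem_map_equiv, Equiv.symm_swap, Finset.mem_filter, Finset.mem_univ,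
    true_and] at hj
  have hne : Equiv.swap 0 n j ≠ 0 := by
    rwa [Ne, Equiv.swap_apply_eq_iff, Equiv.swap_apply_left]
  simp only [pointNode, Function.comp_apply, Function.update_of_ne hne, stack_apply, if_pos hj]

theorem map_pointNode_dropped (hl : qs.length < N) :
    (Finset.univ \ (pointNode n a z qs).2).val.map (pointNode n a z qs).1 = (qs : Multiset ℝ) := by
  have hsdiff : Finset.univ \ (pointNode n a z qs).2
      = (Finset.univ \ Finset.univ.filter fun i : Fin N => (i : ℕ) < N - qs.length).map
          (Equiv.swap 0 n).toEmbedding := by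
    rw [Finset.map_sdiff, Finset.map_univ_equiv, pointNode]
  rw [hsdiff, Finset.map_val, Multiset.map_map, ← map_sdiff_filter_stack z hl.le]
  refine Multiset.map_congr rfl fun i hi => ?_
  have hne : i ≠ 0 := by
    rintro rfl
    rw [Finset.mem_val, Finset.mem_sdiff] at hi
    refine hi.2 (Finset.mem_filter.2 ⟨Finset.mem_univ _, ?_⟩)
    rw [Fin.val_zero]
    omega
  simp [pointNode, hne]

variable {w : (Fin N → ℝ) → ℝ} {V : Fin N → (Fin N → ℝ) → ℝ → ℝ} {q : List ℝ → ℝ} {h : List ℝ}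
  {c : EReal}

theorem pointNode_isConsistent (hq : IsInference w I q) (ha : a ∈ I) (hz : z ∈ I)
    (hl : h.length < N) (hle : c ≤ (bid w q z h : ℝ)) :
    IsConsistent w I q n (pointNode n a z (inferred q h)).1 (pointNode n a z (inferred q h)).2
      h c where
  mem := pointNode_fst_mem ha hz (hq.inferred_mem h)
  active := mem_pointNode_snd (by rwa [length_inferred])
  card := by
    simpa only [length_inferred] using
      card_pointNode_snd (n := n) (a := a) (z := z) ((length_inferred q h).trans_le hl.le)
  dropped := map_pointNode_dropped (by rwa [length_inferred])
  le_bid j hj hjn := by rwa [pointNode_fst_of_ne hj hjn]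

/-- If some signal bids above the clock, the others are believed to have it; otherwise they are
believed to have the same signal as `n`, so that winning at the clock price is no gain. -/
theorem exists_forall_nodePayoff_pointNode_le (R : IsPriceRule I w V) (hq : IsInference w I q)
    (ρ : Equiv.Perm (Fin N)) (n : Fin N) (hi : IsInfoSet N I a h c) :
    ∃ z ∈ I, ∀ σ : Fin N → Strategy, (∀ j ≠ n, σ j = bid w q) →
      nodePayoff V ρ σ n h c (pointNode n a z (inferred q h))
        ≤ nodePayoff V ρ (fun _ => bid w q) n h c (pointNode n a z (inferred q h)) := by
  have hl := hi.length_le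
  have ha := hi.signal_mem
  have hql : (inferred q h).length < N := by rw [length_inferred]; omega
  have hcard (z : ℝ) : (pointNode n a z (inferred q h)).2.card + h.length = N := by
    simpa only [length_inferred] using card_pointNode_snd (n := n) (a := a) (z := z) hql.le
  by_cases! hex : ∃ z ∈ I, c < (bid w q z h : ℝ)
  · obtain ⟨z, hz, hlt⟩ := hex
    refine ⟨z, hz, fun σ hσ => ?_⟩
    have hc := pointNode_isConsistent (n := n) hq ha hz (by omega) hlt.le
    have hS : 2 ≤ (pointNode n a z (inferred q h)).2.card := by have := hcard z; omega
    have hbid : ∀ j ∈ (pointNode n a z (inferred q h)).2, j ≠ n →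
        c < (bid w q ((pointNode n a z (inferred q h)).1 j) h : ℝ) := fun j hj hjn => by
      rwa [pointNode_fst_of_ne hj hjn]
    exact hc.nodePayoff_le R hq hσ hS (Or.inr hbid)
  · lift c to ℝ using ⟨hi.lt_top.ne, ne_bot_of_le_ne_bot (EReal.coe_ne_bot _) (hex a ha)⟩
    have hle : ∀ z ∈ I, bid w q z h ≤ c := fun z hz => EReal.coe_le_coe_iff.1 (hex z hz)
    have hmem := pointNode_fst_mem (n := n) ha ha (hq.inferred_mem h)
    have hprice : w ((pointNode n a a (inferred q h)).1 ∘ Equiv.swap 0 n) ≤ c := by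
      rw [pointNode_fst_comp_swap hql]
      exact hle a ha
    exact ⟨a, ha, fun σ hσ => nodePayoff_le_of_forall_bid_le R hq hσ hmem
      (mem_pointNode_snd (a := a) (z := a) hql) (hcard a) hle (R.nonpos n hmem hprice)⟩

end PointNode

section OrderPath

variable {N : ℕ} [NeZero N]

/-- The buyer in `S` other than `n` who leaves first if they leave in the order of their signals
`y`. -/
def nextOut (ρ : Equiv.Perm (Fin N)) (n : Fin N) (S : Finset (Fin N)) (y : Fin N → ℝ) : Fin N :=
  firstOut ρ y (S.erase n)

/-- Signals of those who have left, most recent first, and set of active buyers after `m`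
drop-outs, if the buyers other than `n` leave in the order of their signals `y`. -/
def orderPath (ρ : Equiv.Perm (Fin N)) (n : Fin N) (y : Fin N → ℝ) :
    ℕ → List ℝ × Finset (Fin N)
  | 0 => ([], Finset.univ)
  | m + 1 =>
    let s := orderPath ρ n y m
    let i := nextOut ρ n s.2 y
    (y i :: s.1, s.2.erase i)

/-- The `(m + 1)`-st drop-out price under the price rule `w`, if the buyers other than `n` leave in
the order of their signals `y`. Unlike the candidate strategy it does not involve inferences. -/
def nextPrice (w : (Fin N → ℝ) → ℝ) (ρ : Equiv.Perm (Fin N)) (n : Fin N) (m : ℕ)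
    (y : Fin N → ℝ) : ℝ :=
  w (stack N (y (nextOut ρ n (orderPath ρ n y m).2 y)) (orderPath ρ n y m).1)

/-- The first `m` of the prices `nextPrice`, most recent first. -/
def pricePath (w : (Fin N → ℝ) → ℝ) (ρ : Equiv.Perm (Fin N)) (n : Fin N) (y : Fin N → ℝ) :
    ℕ → List ℝ
  | 0 => []
  | m + 1 => nextPrice w ρ n m y :: pricePath w ρ n y m

theorem length_pricePath (w : (Fin N → ℝ) → ℝ) (ρ : Equiv.Perm (Fin N)) (n : Fin N)
    (y : Fin N → ℝ) (m : ℕ) : (pricePath w ρ n y m).length = m := by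
  induction m with
  | zero => rfl
  | succ m ih => rw [pricePath, List.length_cons, ih]

/-- After `m` drop-outs the auction in which buyer `n` stays in and the others use the candidate
strategy has followed the order of the signals `y`, and it has revealed them. -/
structure IsOnPath (w : (Fin N → ℝ) → ℝ) (I : Set ℝ) (q : List ℝ → ℝ) (ρ : Equiv.Perm (Fin N))
    (n : Fin N) (y : Fin N → ℝ) (m : ℕ) : Prop where
  path_eq : pathStaying ρ (fun _ => bid w q) y n m = (pricePath w ρ n y m, (orderPath ρ n y m).2)
  inferred_eq : inferred q (pricePath w ρ n y m) = (orderPath ρ n y m).1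
  consistent : IsConsistent w I q n y (orderPath ρ n y m).2 (pricePath w ρ n y m)
    (clock (pricePath w ρ n y m))
  ordered : ∀ d ∉ (orderPath ρ n y m).2, ∀ j ∈ (orderPath ρ n y m).2, j ≠ n → y d ≤ y j

variable {I : Set ℝ} {w : (Fin N → ℝ) → ℝ} {V : Fin N → (Fin N → ℝ) → ℝ → ℝ}
  {q : List ℝ → ℝ} {ρ : Equiv.Perm (Fin N)} {n j : Fin N} {y : Fin N → ℝ} {S : Finset (Fin N)}
  {h : List ℝ} {c : EReal} {m : ℕ} {σ : Fin N → Strategy}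

theorem nextOut_le (hj : j ∈ S) (hjn : j ≠ n) : y (nextOut ρ n S y) ≤ y j :=
  firstOut_le ρ y (Finset.mem_erase.2 ⟨hjn, hj⟩)

theorem IsConsistent.nextOut_mem_erase (hc : IsConsistent w I q n y S h c)
    (hl : h.length + 2 ≤ N) : nextOut ρ n S y ∈ S.erase n :=
  firstOut_mem ρ y (hc.nonempty_erase hl)

theorem IsConsistent.firstOut_erase_eq_nextOut (R : IsPriceRule I w V) (hq : IsInference w I q)
    (hσ : ∀ j ≠ n, σ j = bid w q) (hc : IsConsistent w I q n y S h c) (hl : h.length + 2 ≤ N) :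
    firstOut ρ (exitPrice σ y h c) (S.erase n) = nextOut ρ n S y := by
  refine firstOut_congr (hc.nonempty_erase hl) fun i hi j hj => ?_
  obtain ⟨hin, hi⟩ := Finset.mem_erase.1 hi
  obtain ⟨hjn, hj⟩ := Finset.mem_erase.1 hj
  rw [hc.exitPrice_eq_bid hσ hi hin, hc.exitPrice_eq_bid hσ hj hjn]
  exact (strictMonoOn_bid R hq (by omega)).le_iff_le (hc.mem i) (hc.mem j)

theorem IsOnPath.bid_nextOut (hp : IsOnPath w I q ρ n y m) :
    bid w q (y (nextOut ρ n (orderPath ρ n y m).2 y)) (pricePath w ρ n y m)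
      = nextPrice w ρ n m y := by
  rw [bid, hp.inferred_eq, nextPrice]

theorem IsOnPath.succ (R : IsPriceRule I w V) (hq : IsInference w I q)
    (hp : IsOnPath w I q ρ n y m) (hm : m + 2 ≤ N) : IsOnPath w I q ρ n y (m + 1) := by
  have hl : (pricePath w ρ n y m).length + 2 ≤ N := by rwa [length_pricePath]
  obtain ⟨hin, hi⟩ := Finset.mem_erase.1 (hp.consistent.nextOut_mem_erase (ρ := ρ) hl)
  have hprice : pricePath w ρ n y (m + 1)
      = bid w q (y (nextOut ρ n (orderPath ρ n y m).2 y)) (pricePath w ρ n y m)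
        :: pricePath w ρ n y m := by
    rw [pricePath, hp.bid_nextOut]
  refine ⟨?_, ?_, ?_, fun d hd j hj hjn => ?_⟩
  · simp only [pathStaying, hp.path_eq,
      hp.consistent.firstOut_erase_eq_nextOut R hq (fun _ _ => rfl) hl]
    rw [hp.consistent.exitPrice_eq_bid (fun _ _ => rfl) hi hin, hprice, orderPath]
  · rw [hprice, inferred, hp.inferred_eq, inference_bid_cons R hq hl (hp.consistent.mem _),
      orderPath]
  · rw [hprice, orderPath]
    exact hp.consistent.erase R hq hi hin fun j hj hjn => nextOut_le hj hjn
  · have hjS := Finset.mem_of_mem_erase hj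
    rcases eq_or_ne d (nextOut ρ n (orderPath ρ n y m).2 y) with rfl | hdi
    · exact nextOut_le hjS hjn
    · exact hp.ordered d (fun hdS => hd (Finset.mem_erase.2 ⟨hdi, hdS⟩)) j hjS hjn

theorem isOnPath (R : IsPriceRule I w V) (hq : IsInference w I q) (ρ : Equiv.Perm (Fin N))
    (n : Fin N) (hy : y ∈ signalSpace N I) (hm : m + 1 ≤ N) : IsOnPath w I q ρ n y m := by
  induction m with
  | zero =>
    exact ⟨rfl, rfl, ⟨hy, Finset.mem_univ n, by simp [orderPath, pricePath],
      by simp [orderPath, pricePath, inferred], fun _ _ _ => bot_le⟩,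
      fun d hd => absurd (Finset.mem_univ d) hd⟩
  | succ m ih => exact (ih (by omega)).succ R hq hm

theorem IsOnPath.lt_bid (R : IsPriceRule I w V) (hq : IsInference w I q)
    (hp : IsOnPath w I q ρ n y m) (hlt : c < (nextPrice w ρ n m y : ℝ))
    (hj : j ∈ (orderPath ρ n y m).2) (hjn : j ≠ n) :
    c < (bid w q (y j) (pricePath w ρ n y m) : ℝ) := by
  refine hlt.trans_le (EReal.coe_le_coe_iff.2 ?_)
  have hl := hp.consistent.length_add_two_le hj hjn
  rw [← hp.bid_nextOut]
  exact (strictMonoOn_bid R hq (by omega)).monotoneOn (hp.consistent.mem _) (hp.consistent.mem j)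
    (nextOut_le hj hjn)

theorem IsOnPath.isConsistent_of_lt (R : IsPriceRule I w V) (hq : IsInference w I q)
    (hp : IsOnPath w I q ρ n y m) (hlt : c < (nextPrice w ρ n m y : ℝ)) :
    IsConsistent w I q n y (orderPath ρ n y m).2 (pricePath w ρ n y m) c :=
  { hp.consistent with le_bid := fun _ hj hjn => (hp.lt_bid R hq hlt hj hjn).le }

theorem IsOnPath.exists_max_eq_topOther (hp : IsOnPath w I q ρ n y m) (hm : m + 2 ≤ N) :
    ∃ i ∈ (orderPath ρ n y m).2, i ≠ n ∧ (∀ j ∈ (orderPath ρ n y m).2, j ≠ n → y j ≤ y i) ∧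
      y i = topOther n y := by
  obtain ⟨i, hi, hmax⟩ := ((orderPath ρ n y m).2.erase n).exists_max_image y
    (hp.consistent.nonempty_erase (by rwa [length_pricePath]))
  obtain ⟨hin, hi⟩ := Finset.mem_erase.1 hi
  have hmax' : ∀ j ∈ (orderPath ρ n y m).2, j ≠ n → y j ≤ y i :=
    fun j hj hjn => hmax j (Finset.mem_erase.2 ⟨hjn, hj⟩)
  refine ⟨i, hi, hin, hmax', le_antisymm ?_ ?_⟩
  · exact le_ciSup (f := fun j : {j : Fin N // j ≠ n} => y j) (Set.finite_range _).bddAbove ⟨i, hin⟩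
  · obtain ⟨j, hjn, hj⟩ := exists_eq_topOther (by omega) n y
    rw [← hj]
    by_cases hjS : j ∈ (orderPath ρ n y m).2
    · exact hmax' j hjS hjn
    · exact hp.ordered j hjS i hi hin

end OrderPath

/-! ### Measurability of the play -/

section MeasurableList

variable {E : Type*} [MeasurableSpace E]

/-- A list-valued map whose values have length `m` and measurable entries. Lists carry no σ-algebra
in Mathlib. -/
structure MeasurableList (m : ℕ) (L : E → List ℝ) : Prop where
  length_eq : ∀ x, (L x).length = m
  measurable_getD : ∀ j, Measurable fun x => (L x).getD j 0

variable {m : ℕ} {L : E → List ℝ} {g : E → ℝ}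

theorem MeasurableList.nil : MeasurableList 0 fun _ : E => [] :=
  ⟨fun _ => rfl, fun _ => measurable_const⟩

theorem MeasurableList.cons (hL : MeasurableList m L) (hg : Measurable g) :
    MeasurableList (m + 1) fun x => g x :: L x := by
  refine ⟨fun x => by simp only [List.length_cons, hL.length_eq], fun j => ?_⟩
  cases j with
  | zero => simpa only [List.getD_cons_zero] using hg
  | succ j => simpa only [List.getD_cons_succ] using hL.measurable_getD j

theorem ofFn_getD {l : List ℝ} (hl : l.length = m) :
    (List.ofFn fun j : Fin m => l.getD j 0) = l := by
  subst hl
  exact List.ext_getElem (by simp) fun i h₁ h₂ => by simp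

theorem MeasurableList.measurable_strategy (hL : MeasurableList m L) {τ : Strategy}
    (hτ : τ.IsMeasurable) (hg : Measurable g) : Measurable fun x => τ (g x) (L x) := by
  have hcomp : (fun x => τ (g x) (L x)) = (fun z : ℝ × (Fin m → ℝ) => τ z.1 (List.ofFn z.2)) ∘
      fun x => (g x, fun j : Fin m => (L x).getD j 0) := by
    funext x
    simp only [Function.comp_apply, ofFn_getD (hL.length_eq x)]
  rw [hcomp]
  exact (hτ m).comp (hg.prodMk (measurable_pi_lambda _ fun j => hL.measurable_getD j))

theorem MeasurableList.measurable_stack {N : ℕ} (hL : MeasurableList m L) (hg : Measurable g) :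
    Measurable fun x => stack N (g x) (L x) := by
  refine measurable_pi_lambda _ fun i => ?_
  simp only [stack_apply, hL.length_eq]
  split_ifs with hi
  · exact hg
  · by_cases hlt : (i : ℕ) - (N - m) < m
    · convert hL.measurable_getD (i - (N - m)) using 2 with x
      rw [← hL.length_eq x] at hlt
      simp only [← hL.length_eq x, List.getD_eq_getElem _ _ hlt]
    · convert hg using 2 with x
      exact List.getD_eq_default _ _ (by rw [hL.length_eq]; exact not_lt.1 hlt)

end MeasurableList

section MeasurablePath

variable {N : ℕ} {E : Type*} [MeasurableSpace E] {g : E → Fin N → ℝ} {i : E → Fin N}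
  {D : E → Finset (Fin N)}

theorem measurable_apply_comp (hg : Measurable g) (hi : Measurable i) :
    Measurable fun x => g x (i x) := by
  have happly : Measurable fun z : (Fin N → ℝ) × Fin N => z.1 z.2 :=
    measurable_from_prod_countable_left fun i => measurable_pi_apply i
  exact happly.comp (hg.prodMk hi)

theorem measurable_erase_comp (hD : Measurable D) (hi : Measurable i) :
    Measurable fun x => (D x).erase (i x) :=
  (measurable_of_countable fun z : Finset (Fin N) × Fin N => z.1.erase z.2).comp (hD.prodMk hi)

variable [NeZero N]

theorem measurable_firstOut (ρ : Equiv.Perm (Fin N)) (D : Finset (Fin N)) :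
    Measurable fun y : Fin N → ℝ => firstOut ρ y D := by
  rcases D.eq_empty_or_nonempty with rfl | hD
  · simp only [firstOut, Finset.notMem_empty, false_and]
    exact measurable_const
  · refine measurable_to_countable' fun i => ?_
    have hpre : (fun y : Fin N → ℝ => firstOut ρ y D) ⁻¹' {i}
        = {y | i ∈ D ∧ ∀ j ∈ D, y i < y j ∨ (y i = y j ∧ ρ i ≤ ρ j)} := by
      ext y
      simp only [Set.mem_preimage, Set.mem_singleton_iff, Set.mem_ofPred_eq]
      refine ⟨?_, fun h => firstOut_eq h.1 h.2⟩
      rintro rfl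
      exact firstOut_spec ρ y hD
    rw [hpre]
    measurability

theorem measurable_firstOut_comp (ρ : Equiv.Perm (Fin N)) (hg : Measurable g) (hD : Measurable D) :
    Measurable fun x => firstOut ρ (g x) (D x) := by
  have hfirst : Measurable fun z : (Fin N → ℝ) × Finset (Fin N) => firstOut ρ z.1 z.2 :=
    measurable_from_prod_countable_left fun D => measurable_firstOut ρ D
  exact hfirst.comp (hg.prodMk hD)

variable (ρ : Equiv.Perm (Fin N)) (n : Fin N) (m : ℕ)

theorem measurable_snd_orderPath : Measurable fun y => (orderPath ρ n y m).2 := by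
  induction m with
  | zero => exact measurable_const
  | succ m ih =>
    exact measurable_erase_comp ih
      (measurable_firstOut_comp ρ measurable_id (measurable_erase_comp ih measurable_const))

theorem measurable_nextOut_orderPath : Measurable fun y => nextOut ρ n (orderPath ρ n y m).2 y :=
  measurable_firstOut_comp ρ measurable_id
    (measurable_erase_comp (measurable_snd_orderPath ρ n m) measurable_const)

theorem measurableList_fst_orderPath : MeasurableList m fun y => (orderPath ρ n y m).1 := by
  induction m with
  | zero => exact .nil
  | succ m ih =>
    exact ih.cons (measurable_apply_comp measurable_id (measurable_nextOut_orderPath ρ n m))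

variable {w : (Fin N → ℝ) → ℝ}

theorem measurable_nextPrice (hw : Measurable w) : Measurable (nextPrice w ρ n m) :=
  hw.comp ((measurableList_fst_orderPath ρ n m).measurable_stack
    (measurable_apply_comp measurable_id (measurable_nextOut_orderPath ρ n m)))

theorem measurableList_pricePath (hw : Measurable w) :
    MeasurableList m fun y => pricePath w ρ n y m := by
  induction m with
  | zero => exact .nil
  | succ m ih => exact ih.cons (measurable_nextPrice ρ n m hw)

end MeasurablePath

section MeasurableNodes

variable {N : ℕ}

/-- A measurable family of nodes `(y, S y)`, `y ∈ G`, with `k + 1` active buyers, each consistent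
for buyer `n` with the `m` drop-out prices `h y` and the clock price `c y`. Inference rules need
not be measurable, so the inferred signals `L y` are part of the data. -/
structure MeasurableNodes (w : (Fin N → ℝ) → ℝ) (I : Set ℝ) (q : List ℝ → ℝ) (n : Fin N) (k m : ℕ)
    (G : Set (Fin N → ℝ)) (h L : (Fin N → ℝ) → List ℝ) (c : (Fin N → ℝ) → EReal)
    (S : (Fin N → ℝ) → Finset (Fin N)) : Prop where
  measurableSet : MeasurableSet G
  prices : MeasurableList m h
  signals : MeasurableList m L
  clock : Measurable c
  active : Measurable S
  consistent : ∀ y ∈ G, IsConsistent w I q n y (S y) (h y) (c y)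
  inferred_eq : ∀ y ∈ G, inferred q (h y) = L y
  card_eq : ∀ y ∈ G, (S y).card = k + 1

variable {w : (Fin N → ℝ) → ℝ} {I : Set ℝ} {q : List ℝ → ℝ} {n : Fin N} {k m : ℕ}
  {G : Set (Fin N → ℝ)} {h L : (Fin N → ℝ) → List ℝ} {c : (Fin N → ℝ) → EReal}
  {S : (Fin N → ℝ) → Finset (Fin N)} {σ : Fin N → Strategy}

theorem MeasurableNodes.mono (F : MeasurableNodes w I q n k m G h L c S) {G' : Set (Fin N → ℝ)}
    (hG' : MeasurableSet G') (hsub : G' ⊆ G) : MeasurableNodes w I q n k m G' h L c S :=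
  { F with
    measurableSet := hG'
    consistent := fun y hy => F.consistent y (hsub hy)
    inferred_eq := fun y hy => F.inferred_eq y (hsub hy)
    card_eq := fun y hy => F.card_eq y (hsub hy) }

theorem MeasurableNodes.exists_measurable_exitPrice (F : MeasurableNodes w I q n k m G h L c S)
    (hw : Measurable w) (hσ : ∀ j ≠ n, σ j = bid w q) (hn : (σ n).IsMeasurable) :
    ∃ b : (Fin N → ℝ) → Fin N → ℝ, Measurable b ∧
      ∀ y ∈ G, ∀ j ∈ S y, exitPrice σ y (h y) (c y) j = b y j := by
  refine ⟨fun y j => if j = n then exitPrice σ y (h y) (c y) n else w (stack N (y j) (L y)),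
    measurable_pi_lambda _ fun j => ?_, fun y hy j hj => ?_⟩
  · split_ifs
    · have hbid := F.prices.measurable_strategy hn (measurable_pi_apply n)
      exact (F.clock.max hbid.coe_real_ereal).ereal_toReal
    · exact hw.comp (F.signals.measurable_stack (measurable_pi_apply j))
  · dsimp only
    split_ifs with hjn
    · rw [hjn]
    · rw [(F.consistent y hy).exitPrice_eq_bid hσ hj hjn, bid, F.inferred_eq y hy]

variable [NeZero N] {V : Fin N → (Fin N → ℝ) → ℝ → ℝ}

theorem MeasurableNodes.exists_measurable_firstOut (F : MeasurableNodes w I q n k m G h L c S)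
    (hw : Measurable w) (ρ : Equiv.Perm (Fin N)) (hσ : ∀ j ≠ n, σ j = bid w q)
    (hn : (σ n).IsMeasurable) : ∃ i : (Fin N → ℝ) → Fin N, Measurable i ∧
      ∀ y ∈ G, firstOut ρ (exitPrice σ y (h y) (c y)) (S y) = i y := by
  obtain ⟨b, hb, hexit⟩ := F.exists_measurable_exitPrice hw hσ hn
  refine ⟨_, measurable_firstOut_comp ρ hb F.active, fun y hy =>
    firstOut_congr ⟨n, (F.consistent y hy).active⟩ fun j hj l hl => ?_⟩
  rw [hexit y hy j hj, hexit y hy l hl]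

theorem MeasurableNodes.erase (R : IsPriceRule I w V) (hq : IsInference w I q)
    (F : MeasurableNodes w I q n (k + 1) m G h L c S) (hw : Measurable w)
    {i : (Fin N → ℝ) → Fin N} (hi : Measurable i) (hin : ∀ y ∈ G, i y ≠ n)
    (hmin : ∀ y ∈ G, i y ∈ S y ∧ ∀ j ∈ S y, j ≠ n → y (i y) ≤ y j) :
    MeasurableNodes w I q n k (m + 1) G (fun y => w (stack N (y (i y)) (L y)) :: h y)
      (fun y => y (i y) :: L y) (fun y => (w (stack N (y (i y)) (L y)) : ℝ))
      (fun y => (S y).erase (i y)) := by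
  have hsignal := measurable_apply_comp measurable_id hi
  have hprice := hw.comp (F.signals.measurable_stack hsignal)
  have hbid : ∀ y ∈ G, w (stack N (y (i y)) (L y)) = bid w q (y (i y)) (h y) := fun y hy => by
    rw [bid, F.inferred_eq y hy]
  refine ⟨F.measurableSet, F.prices.cons hprice, F.signals.cons hsignal, hprice.coe_real_ereal,
    measurable_erase_comp F.active hi, fun y hy => ?_, fun y hy => ?_, fun y hy => ?_⟩
  · rw [hbid y hy]
    exact (F.consistent y hy).erase R hq (hmin y hy).1 (hin y hy) (hmin y hy).2
  · have hl := (F.consistent y hy).length_add_two_le (hmin y hy).1 (hin y hy)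
    rw [hbid y hy, inferred, inference_bid_cons R hq hl ((F.consistent y hy).mem _),
      F.inferred_eq y hy]
  · rw [Finset.card_erase_of_mem (hmin y hy).1, F.card_eq y hy, Nat.add_sub_cancel]

theorem MeasurableNodes.measurableSet_play_fst_eq (R : IsPriceRule I w V)
    (hq : IsInference w I q) (F : MeasurableNodes w I q n k m G h L c S) (hw : Measurable w)
    (ρ : Equiv.Perm (Fin N)) (hσ : ∀ j ≠ n, σ j = bid w q) (hn : (σ n).IsMeasurable) :
    MeasurableSet {y | y ∈ G ∧ (play ρ σ y k (h y) (c y) (S y)).1 = n} := by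
  induction k generalizing m G h L c S with
  | zero =>
    convert F.measurableSet using 1
    refine Set.ext fun y => and_iff_left_of_imp fun hy => ?_
    have hcard := F.card_eq y hy
    exact Finset.card_le_one.1 hcard.le _ (play_fst_mem ρ σ y 0 _ _ hcard) _
      (F.consistent y hy).active
  | succ k ih =>
    obtain ⟨i, hi, hfirst⟩ := F.exists_measurable_firstOut hw ρ hσ hn
    have hmin : ∀ y ∈ G ∩ {y | i y ≠ n}, i y ∈ S y ∧ ∀ j ∈ S y, j ≠ n → y (i y) ≤ y j :=
      fun y hy => (F.consistent y hy.1).of_firstOut_ne R hq hσ (hfirst y hy.1) hy.2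
    have F' := (F.mono (F.measurableSet.inter (hi (measurableSet_singleton n).compl))
      Set.inter_subset_left).erase R hq hw hi (fun y hy => hy.2) hmin
    convert ih F' using 1
    ext y
    simp only [Set.mem_ofPred_eq, Set.mem_inter_iff, and_assoc]
    refine and_congr_right fun hy => ?_
    have hprice (hin : i y ≠ n) :
        exitPrice σ y (h y) (c y) (i y) = w (stack N (y (i y)) (L y)) := by
      rw [(F.consistent y hy).exitPrice_eq_bid hσ (hmin y ⟨hy, hin⟩).1 hin, bid,
        F.inferred_eq y hy]
    refine ⟨fun hwin => ?_, fun ⟨hin, hwin⟩ => ?_⟩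
    · have hin := (firstOut_ne_play_fst (ρ := ρ) σ y (h y) (c y) (F.card_eq y hy)).trans_eq hwin
      rw [hfirst y hy] at hin
      rw [play_succ k (hfirst y hy) (hprice hin)] at hwin
      exact ⟨hin, hwin⟩
    · rwa [play_succ k (hfirst y hy) (hprice hin)]

end MeasurableNodes

/-! ### Beliefs -/

section Conditioning

variable {Ω E F : Type*} [MeasurableSpace Ω] [MeasurableSpace E] [StandardBorelSpace E] [Nonempty E]
  [MeasurableSpace F] {P : Measure Ω} [IsFiniteMeasure P] {W : Ω → E} {O : Ω → F}

theorem ae_condDistrib (hW : Measurable W) (hO : Measurable O) {p : F × E → Prop}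
    (hp : MeasurableSet {z | p z}) (h : ∀ᵐ ω ∂P, p (O ω, W ω)) :
    ∀ᵐ ω ∂P, ∀ᵐ x ∂(condDistrib W O P (O ω)), p (O ω, x) := by
  rw [← ae_map_iff (hO.prodMk hW).aemeasurable hp, ← compProd_map_condDistrib hW.aemeasurable] at h
  exact ae_of_ae_map hO.aemeasurable (Measure.ae_ae_of_ae_compProd h)

variable {R : Set (F × E)}

theorem setLIntegral_comp_condDistrib (hW : Measurable W) (hO : Measurable O)
    (hR : MeasurableSet R) {g : F → ENNReal} (hg : Measurable g) :
    ∫⁻ ω in {ω | (O ω, W ω) ∈ R}, g (O ω) ∂P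
      = ∫⁻ ω, g (O ω) * condDistrib W O P (O ω) {x | (O ω, x) ∈ R} ∂P :=
  calc ∫⁻ ω in {ω | (O ω, W ω) ∈ R}, g (O ω) ∂P
      = ∫⁻ z in R, g z.1 ∂(P.map fun ω => (O ω, W ω)) :=
        (setLIntegral_map hR (hg.comp measurable_fst) (hO.prodMk hW)).symm
    _ = ∫⁻ o, ∫⁻ x, R.indicator (fun z => g z.1) (o, x) ∂(condDistrib W O P o) ∂(P.map O) := by
        rw [← lintegral_indicator hR, ← compProd_map_condDistrib hW.aemeasurable]
        exact Measure.lintegral_compProd ((hg.comp measurable_fst).indicator hR)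
    _ = ∫⁻ o, g o * condDistrib W O P o {x | (o, x) ∈ R} ∂(P.map O) :=
        lintegral_congr fun o => lintegral_indicator_const (measurable_prodMk_left hR) (g o)
    _ = ∫⁻ ω, g (O ω) * condDistrib W O P (O ω) {x | (O ω, x) ∈ R} ∂P :=
        lintegral_map (hg.mul (Kernel.measurable_kernel_prodMk_left hR)) hO

theorem ae_cond_condDistrib_ne_zero (hW : Measurable W) (hO : Measurable O)
    (hR : MeasurableSet R) :
    ∀ᵐ ω ∂P[|{ω | (O ω, W ω) ∈ R}], condDistrib W O P (O ω) {x | (O ω, x) ∈ R} ≠ 0 := by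
  set K : F → ENNReal := fun o => condDistrib W O P o {x | (o, x) ∈ R}
  have hK : MeasurableSet {o | K o = 0} :=
    measurableSet_eq_fun (Kernel.measurable_kernel_prodMk_left hR) measurable_const
  have hg : Measurable ({o | K o = 0}.indicator 1 : F → ENNReal) := measurable_one.indicator hK
  have hzero : ∫⁻ ω in {ω | (O ω, W ω) ∈ R}, {o | K o = 0}.indicator 1 (O ω) ∂P = 0 := by
    rw [setLIntegral_comp_condDistrib hW hO hR hg]
    refine lintegral_eq_zero_of_ae_eq_zero (.of_forall fun ω => ?_)
    by_cases hω : K (O ω) = 0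
    · exact mul_eq_zero_of_right _ hω
    · exact mul_eq_zero_of_left (Set.indicator_of_notMem (s := {o | K o = 0}) hω 1) _
  refine Measure.ae_smul_measure ?_ _
  filter_upwards [(lintegral_eq_zero_iff (hg.comp hO)).1 hzero] with ω hω hKω
  exact one_ne_zero ((Set.indicator_of_mem (s := {o | K o = 0}) hKω 1).symm.trans hω)

theorem measurable_cond_condDistrib (hR : MeasurableSet R) {D : Set E} (hD : MeasurableSet D) :
    Measurable fun o => (condDistrib W O P o)[|{x | (o, x) ∈ R}] D := by
  have hRo (o : F) : MeasurableSet {x | (o, x) ∈ R} := measurable_prodMk_left hR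
  simp only [cond_apply (hRo _)]
  exact (Kernel.measurable_kernel_prodMk_left hR).inv.mul
    (Kernel.measurable_kernel_prodMk_left (hR.inter (measurable_snd hD)))

theorem setLIntegral_cond_condDistrib (hW : Measurable W) (hO : Measurable O)
    (hR : MeasurableSet R) {D : Set E} (hD : MeasurableSet D) {t : Set F} (ht : MeasurableSet t) :
    ∫⁻ ω in O ⁻¹' t, (condDistrib W O P (O ω))[|{x | (O ω, x) ∈ R}] D ∂P[|{ω | (O ω, W ω) ∈ R}]
      = P[|{ω | (O ω, W ω) ∈ R}] (O ⁻¹' t ∩ W ⁻¹' D) := by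
  have hA : MeasurableSet {ω | (O ω, W ω) ∈ R} := (hO.prodMk hW) hR
  set G : F → ENNReal := fun o => (condDistrib W O P o)[|{x | (o, x) ∈ R}] D
  rw [cond_apply hA, ProbabilityTheory.cond, Measure.restrict_smul, lintegral_smul_measure,
    smul_eq_mul]
  congr 1
  have hG : Measurable G := measurable_cond_condDistrib hR hD
  calc ∫⁻ ω in O ⁻¹' t, G (O ω) ∂P.restrict {ω | (O ω, W ω) ∈ R}
      = ∫⁻ ω in {ω | (O ω, W ω) ∈ R}, t.indicator G (O ω) ∂P := (lintegral_indicator (hO ht) _).symm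
    _ = ∫⁻ ω, t.indicator G (O ω) * condDistrib W O P (O ω) {x | (O ω, x) ∈ R} ∂P :=
        setLIntegral_comp_condDistrib hW hO hR (hG.indicator ht)
    _ = ∫⁻ ω, t.indicator 1 (O ω)
          * condDistrib W O P (O ω) {x | (O ω, x) ∈ R ∩ Prod.snd ⁻¹' D} ∂P := by
        refine lintegral_congr fun ω => ?_
        by_cases hω : O ω ∈ t
        · rw [Set.indicator_of_mem hω, Set.indicator_of_mem hω, Pi.one_apply, one_mul]
          exact cond_mul_eq_inter (measurable_prodMk_left hR) D _
        · rw [Set.indicator_of_notMem hω, Set.indicator_of_notMem hω, zero_mul, zero_mul]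
    _ = ∫⁻ ω in {ω | (O ω, W ω) ∈ R} ∩ W ⁻¹' D, (O ⁻¹' t).indicator 1 ω ∂P :=
        (setLIntegral_comp_condDistrib hW hO (hR.inter (measurable_snd hD))
          (measurable_one.indicator ht)).symm
    _ = P ({ω | (O ω, W ω) ∈ R} ∩ (O ⁻¹' t ∩ W ⁻¹' D)) := by
        rw [lintegral_indicator_one (hO ht), Measure.restrict_apply (hO ht)]
        congr 1
        ext ω
        exact and_left_comm

theorem cond_condDistrib_ae_eq_condExp (hW : Measurable W) (hO : Measurable O)
    (hR : MeasurableSet R) {D : Set E} (hD : MeasurableSet D) :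
    (fun ω => ((condDistrib W O P (O ω))[|{x | (O ω, x) ∈ R}]).real D)
      =ᵐ[P[|{ω | (O ω, W ω) ∈ R}]]
    (P[|{ω | (O ω, W ω) ∈ R}])[(W ⁻¹' D).indicator (fun _ => (1 : ℝ)) |
      MeasurableSpace.comap O inferInstance] := by
  set G : F → ENNReal := fun o => (condDistrib W O P o)[|{x | (o, x) ∈ R}] D
  have hG : Measurable G := measurable_cond_condDistrib hR hD
  have hG1 (o : F) : G o ≤ 1 := prob_le_one
  have hint : Integrable (fun ω => (G (O ω)).toReal) P[|{ω | (O ω, W ω) ∈ R}] :=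
    .of_bound (hG.comp hO).ennreal_toReal.aestronglyMeasurable 1 (.of_forall fun ω => by
      rw [Real.norm_of_nonneg ENNReal.toReal_nonneg]
      exact ENNReal.toReal_mono ENNReal.one_ne_top (hG1 _))
  refine ae_eq_condExp_of_forall_setIntegral_eq hO.comap_le
    ((integrable_const (1 : ℝ)).indicator (hW hD)) (fun s _ _ => hint.integrableOn) ?_
    ((hG.comp (comap_measurable O)).ennreal_toReal).stronglyMeasurable.aestronglyMeasurable
  rintro _ ⟨t, ht, rfl⟩ -
  rw [setIntegral_indicator (hW hD), setIntegral_one_eq_measureReal, measureReal_def,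
    ← setLIntegral_cond_condDistrib hW hO hR hD ht]
  exact integral_toReal (hG.comp hO).aemeasurable
    (.of_forall fun ω => (hG1 _).trans_lt ENNReal.one_lt_top)

end Conditioning

section Reach

variable {N : ℕ} [NeZero N]

/-- What a buyer with signal `a` has observed when the first `m` drop-out prices are `h`, in the
form used by `observed`. -/
def observation (m : ℕ) (a : ℝ) (h : List ℝ) : ℝ × (Fin m → ℝ) := (a, fun j => h.getD j 0)

/-- What buyer `n` observes up to the `m`-th drop-out if the others leave in the order of their
signals. -/
def orderObserved (w : (Fin N → ℝ) → ℝ) (ρ : Equiv.Perm (Fin N)) (n : Fin N) (m : ℕ)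
    (y : Fin N → ℝ) : ℝ × (Fin m → ℝ) :=
  observation m (y n) (pricePath w ρ n y m)

/-- The node after `m` drop-outs if the buyers other than `n` leave in the order of their
signals. -/
def orderNode (ρ : Equiv.Perm (Fin N)) (n : Fin N) (m : ℕ) (y : Fin N → ℝ) : Node N :=
  (y, (orderPath ρ n y m).2)

/-- The signal vectors for which buyer `n` with signal `a` observes the `m` drop-out prices `h` and
no further drop-out up to the clock price `c`. -/
def reachSet (I : Set ℝ) (w : (Fin N → ℝ) → ℝ) (ρ : Equiv.Perm (Fin N)) (n : Fin N) (m : ℕ) (a : ℝ)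
    (h : List ℝ) (c : EReal) : Set (Fin N → ℝ) :=
  {y | (y ∈ signalSpace N I ∧ orderObserved w ρ n m y = observation m a h) ∧
    c < (nextPrice w ρ n m y : ℝ)}

variable {I : Set ℝ} {w : (Fin N → ℝ) → ℝ} {V : Fin N → (Fin N → ℝ) → ℝ → ℝ} {q : List ℝ → ℝ}
  {ρ : Equiv.Perm (Fin N)} {n : Fin N} {m : ℕ} {a : ℝ} {h : List ℝ} {c : EReal} {y : Fin N → ℝ}
  {σ : Fin N → Strategy}

theorem ofFn_orderObserved_snd (w : (Fin N → ℝ) → ℝ) (ρ : Equiv.Perm (Fin N)) (n : Fin N) (m : ℕ)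
    (y : Fin N → ℝ) : List.ofFn (orderObserved w ρ n m y).2 = pricePath w ρ n y m :=
  ofFn_getD (length_pricePath w ρ n y m)

theorem measurable_orderObserved (hw : Measurable w) (ρ : Equiv.Perm (Fin N)) (n : Fin N) (m : ℕ) :
    Measurable (orderObserved w ρ n m) :=
  (measurable_pi_apply n).prodMk
    (measurable_pi_lambda _ fun j => (measurableList_pricePath ρ n m hw).measurable_getD j)

theorem measurableEmbedding_orderNode (ρ : Equiv.Perm (Fin N)) (n : Fin N) (m : ℕ) :
    MeasurableEmbedding (orderNode ρ n m) :=
  (measurable_id.prodMk (measurable_snd_orderPath ρ n m)).measurableEmbedding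
    fun _ _ h => congrArg Prod.fst h

theorem measurable_coe_nextPrice (hw : Measurable w) (ρ : Equiv.Perm (Fin N)) (n : Fin N) (m : ℕ) :
    Measurable fun y => ((nextPrice w ρ n m y : ℝ) : EReal) :=
  (measurable_nextPrice ρ n m hw).coe_real_ereal

theorem measurableSet_reachSet (hI : MeasurableSet (signalSpace N I)) (hw : Measurable w)
    (ρ : Equiv.Perm (Fin N)) (n : Fin N) (m : ℕ) (a : ℝ) (h : List ℝ) (c : EReal) :
    MeasurableSet (reachSet I w ρ n m a h c) :=
  (hI.inter (measurableSet_eq_fun (measurable_orderObserved hw ρ n m) measurable_const)).inter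
    (measurableSet_lt measurable_const (measurable_coe_nextPrice hw ρ n m))

theorem pricePath_eq_of_mem_reachSet (hl : h.length = m) (hy : y ∈ reachSet I w ρ n m a h c) :
    pricePath w ρ n y m = h := by
  rw [← ofFn_orderObserved_snd, hy.1.2]
  exact ofFn_getD hl

theorem isConsistent_of_mem_reachSet (R : IsPriceRule I w V) (hq : IsInference w I q)
    (hl : h.length = m) (hm : m + 2 ≤ N) (hy : y ∈ reachSet I w ρ n m a h c) :
    IsConsistent w I q n y (orderPath ρ n y m).2 h c := by
  have hp := isOnPath R hq ρ n hy.1.1 (show m + 1 ≤ N by omega)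
  rw [← pricePath_eq_of_mem_reachSet hl hy]
  exact hp.isConsistent_of_lt R hq hy.2

theorem lt_bid_of_mem_reachSet (R : IsPriceRule I w V) (hq : IsInference w I q)
    (hl : h.length = m) (hm : m + 2 ≤ N) (hy : y ∈ reachSet I w ρ n m a h c) {j : Fin N}
    (hj : j ∈ (orderPath ρ n y m).2) (hjn : j ≠ n) : c < (bid w q (y j) h : ℝ) := by
  have hp := isOnPath R hq ρ n hy.1.1 (show m + 1 ≤ N by omega)
  rw [← pricePath_eq_of_mem_reachSet hl hy]
  exact hp.lt_bid R hq hy.2 hj hjn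

theorem nodePayoff_orderNode_eq (R : IsPriceRule I w V) (hq : IsInference w I q)
    (hl : h.length = m) (hm : m + 2 ≤ N) (hσ : ∀ j ≠ n, σ j = bid w q)
    (hy : y ∈ reachSet I w ρ n m a h c) :
    nodePayoff V ρ σ n h c (orderNode ρ n m y)
      = if (play ρ σ y ((orderPath ρ n y m).2.card - 1) h c (orderPath ρ n y m).2).1 = n
        then stayUtility V w n y else 0 := by
  have hp := isOnPath R hq ρ n hy.1.1 (show m + 1 ≤ N by omega)
  obtain ⟨i, hi, hin, hmax, htop⟩ := hp.exists_max_eq_topOther hm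
  rw [stayUtility, ← htop]
  exact (isConsistent_of_mem_reachSet R hq hl hm hy).nodePayoff_eq R hq hσ hi hin hmax

theorem nodePayoff_orderNode_bid (R : IsPriceRule I w V) (hq : IsInference w I q)
    (hl : h.length = m) (hm : m + 2 ≤ N) (hy : y ∈ reachSet I w ρ n m a h c) :
    nodePayoff V ρ (fun _ => bid w q) n h c (orderNode ρ n m y) = max (stayUtility V w n y) 0 := by
  have hp := isOnPath R hq ρ n hy.1.1 (show m + 1 ≤ N by omega)
  obtain ⟨i, hi, hin, hmax, htop⟩ := hp.exists_max_eq_topOther hm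
  rw [stayUtility, ← htop]
  exact (isConsistent_of_mem_reachSet R hq hl hm hy).nodePayoff_bid R hq hi hin hmax
    (Or.inr fun j hj hjn => lt_bid_of_mem_reachSet R hq hl hm hy hj hjn)

theorem nodePayoff_orderNode_le (R : IsPriceRule I w V) (hq : IsInference w I q)
    (hl : h.length = m) (hm : m + 2 ≤ N) (hσ : ∀ j ≠ n, σ j = bid w q)
    (hy : y ∈ reachSet I w ρ n m a h c) :
    nodePayoff V ρ σ n h c (orderNode ρ n m y)
      ≤ nodePayoff V ρ (fun _ => bid w q) n h c (orderNode ρ n m y) := by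
  have hc := isConsistent_of_mem_reachSet R hq hl hm hy
  refine hc.nodePayoff_le R hq hσ (by have := hc.card; omega)
    (Or.inr fun j hj hjn => lt_bid_of_mem_reachSet R hq hl hm hy hj hjn)

theorem measurableNodes_orderPath (R : IsPriceRule I w V) (hq : IsInference w I q)
    (hw : Measurable w) (hI : MeasurableSet (signalSpace N I)) (ρ : Equiv.Perm (Fin N)) (n : Fin N)
    (hl : h.length = m) (hm : m + 2 ≤ N) :
    MeasurableNodes w I q n (N - m - 1) m (reachSet I w ρ n m a h c) (fun _ => h)
      (fun _ => inferred q h) (fun _ => c) fun y => (orderPath ρ n y m).2 where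
  measurableSet := measurableSet_reachSet hI hw ρ n m a h c
  prices := ⟨fun _ => hl, fun _ => measurable_const⟩
  signals := ⟨fun _ => (length_inferred q h).trans hl, fun _ => measurable_const⟩
  clock := measurable_const
  active := measurable_snd_orderPath ρ n m
  consistent _ hy := isConsistent_of_mem_reachSet R hq hl hm hy
  inferred_eq _ _ := rfl
  card_eq y hy := by
    have hcard := (isConsistent_of_mem_reachSet R hq hl hm hy).card
    omega

variable {ν : Measure (Fin N → ℝ)}

theorem integrable_nodePayoff_bid (R : IsPriceRule I w V) (hq : IsInference w I q)
    (hl : h.length = m) (hm : m + 2 ≤ N) (hν : ∀ᵐ y ∂ν, y ∈ reachSet I w ρ n m a h c)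
    (hint : Integrable (stayUtility V w n) ν) :
    Integrable (nodePayoff V ρ (fun _ => bid w q) n h c) (ν.map (orderNode ρ n m)) := by
  rw [(measurableEmbedding_orderNode ρ n m).integrable_map_iff]
  refine (hint.sup (integrable_zero _ ℝ _)).congr ?_
  filter_upwards [hν] with y hy using (nodePayoff_orderNode_bid R hq hl hm hy).symm

theorem integrable_nodePayoff (R : IsPriceRule I w V) (hq : IsInference w I q) (hw : Measurable w)
    (hI : MeasurableSet (signalSpace N I)) (hl : h.length = m) (hm : m + 2 ≤ N)
    (hσ : ∀ j ≠ n, σ j = bid w q) (hn : (σ n).IsMeasurable)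
    (hν : ∀ᵐ y ∂ν, y ∈ reachSet I w ρ n m a h c) (hint : Integrable (stayUtility V w n) ν) :
    Integrable (nodePayoff V ρ σ n h c) (ν.map (orderNode ρ n m)) := by
  rw [(measurableEmbedding_orderNode ρ n m).integrable_map_iff]
  have F := measurableNodes_orderPath (a := a) (c := c) R hq hw hI ρ n hl hm
  refine (hint.indicator (F.measurableSet_play_fst_eq R hq hw ρ hσ hn)).congr ?_
  filter_upwards [hν] with y hy
  rw [Function.comp_apply, nodePayoff_orderNode_eq R hq hl hm hσ hy, F.card_eq y hy,
    Nat.add_sub_cancel]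
  split_ifs with hwin
  · refine Set.indicator_of_mem ?_ _
    exact ⟨hy, hwin⟩
  · refine Set.indicator_of_notMem ?_ _
    exact fun hmem => hwin hmem.2

end Reach

section Belief

variable {Ω : Type*} [MeasurableSpace Ω] {N : ℕ} [NeZero N]

/-- The conditional law of the signal vector `Y` given what buyer `n` has observed after `m`
drop-outs. -/
abbrev signalLaw (P : Measure Ω) [IsFiniteMeasure P] (Y : Ω → Fin N → ℝ) (w : (Fin N → ℝ) → ℝ)
    (ρ : Equiv.Perm (Fin N)) (n : Fin N) (m : ℕ) : Kernel (ℝ × (Fin m → ℝ)) (Fin N → ℝ) :=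
  condDistrib Y (fun ω => orderObserved w ρ n m (Y ω)) P

/-- The conditional law of the signal vector `Y` given the observations of buyer `n` and the event
that the clock has passed `c` without a further drop-out. -/
def clockLaw (P : Measure Ω) [IsFiniteMeasure P] (Y : Ω → Fin N → ℝ) (w : (Fin N → ℝ) → ℝ)
    (ρ : Equiv.Perm (Fin N)) (n : Fin N) (m : ℕ) (a : ℝ) (h : List ℝ) (c : EReal) :
    Measure (Fin N → ℝ) :=
  (signalLaw P Y w ρ n m (observation m a h))[|{y | c < (nextPrice w ρ n m y : ℝ)}]

/-- The information set is one at which the belief is determined by Bayes' rule: the version of the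
conditional law of the signals is well behaved there, and the clock price `c` has positive
conditional probability. Almost every information set that is reached is of this kind. -/
structure IsRegular (P : Measure Ω) [IsFiniteMeasure P] (Y : Ω → Fin N → ℝ) (I : Set ℝ)
    (V : Fin N → (Fin N → ℝ) → ℝ → ℝ) (w : (Fin N → ℝ) → ℝ) (ρ : Equiv.Perm (Fin N)) (n : Fin N)
    (m : ℕ) (a : ℝ) (h : List ℝ) (c : EReal) : Prop where
  ae_observed : ∀ᵐ y ∂(signalLaw P Y w ρ n m (observation m a h)),
    y ∈ signalSpace N I ∧ orderObserved w ρ n m y = observation m a h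
  integrable : Integrable (stayUtility V w n) (signalLaw P Y w ρ n m (observation m a h))
  clock_ne_zero :
    signalLaw P Y w ρ n m (observation m a h) {y | c < (nextPrice w ρ n m y : ℝ)} ≠ 0

open Classical in
/-- The belief given by Bayes' rule at regular information sets, and concentrated at the given nodes
`d₀` at the others. -/
def belief (P : Measure Ω) [IsFiniteMeasure P] (Y : Ω → Fin N → ℝ) (I : Set ℝ)
    (V : Fin N → (Fin N → ℝ) → ℝ → ℝ) (w : (Fin N → ℝ) → ℝ) (ρ : Equiv.Perm (Fin N))
    (d₀ : Fin N → ℝ → List ℝ → EReal → Node N) : Beliefs N := fun n a h c =>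
  if IsRegular P Y I V w ρ n h.length a h c then
    (clockLaw P Y w ρ n h.length a h c).map (orderNode ρ n h.length)
  else Measure.dirac (d₀ n a h c)

/-- Pairs of an observation and a signal vector such that the clock price `T`, which may depend on
the observation, lies between the last observed and the next drop-out price. -/
def clockSet (w : (Fin N → ℝ) → ℝ) (ρ : Equiv.Perm (Fin N)) (n : Fin N) (m : ℕ)
    (T : ℝ × (Fin m → ℝ) → EReal) : Set ((ℝ × (Fin m → ℝ)) × (Fin N → ℝ)) :=
  {z | clock (List.ofFn z.1.2) ≤ T z.1 ∧ T z.1 < (nextPrice w ρ n m z.2 : ℝ)}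

/-- What a belief needs to satisfy at an information set of buyer `n` in order that the candidate
strategy be optimal there and the signals of those who have left be the inferred ones. -/
structure IsRationalBelief (I : Set ℝ) (w : (Fin N → ℝ) → ℝ) (V : Fin N → (Fin N → ℝ) → ℝ → ℝ)
    (q : List ℝ → ℝ) (ρ : Equiv.Perm (Fin N)) (n : Fin N) (a : ℝ) (h : List ℝ) (c : EReal)
    (ν : Measure (Node N)) : Prop where
  isProbabilityMeasure : IsProbabilityMeasure ν
  ae_node : ∀ᵐ d ∂ν, d.1 ∈ signalSpace N I ∧ d.1 n = a ∧ n ∈ d.2 ∧ d.2.card + h.length = N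
  ae_inferred : ∀ᵐ d ∂ν, (Finset.univ \ d.2).val.map d.1 = (inferred q h : Multiset ℝ)
  ae_le : ∀ σ : Fin N → Strategy, (∀ j ≠ n, σ j = bid w q) →
    ∀ᵐ d ∂ν, nodePayoff V ρ σ n h c d ≤ nodePayoff V ρ (fun _ => bid w q) n h c d
  integrable_bid : Integrable (nodePayoff V ρ (fun _ => bid w q) n h c) ν
  integrable : ∀ σ : Fin N → Strategy, (∀ j ≠ n, σ j = bid w q) → (σ n).IsMeasurable →
    Integrable (nodePayoff V ρ σ n h c) ν

variable {P : Measure Ω} [IsFiniteMeasure P] {Y : Ω → Fin N → ℝ} {I : Set ℝ}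
  {w : (Fin N → ℝ) → ℝ} {V : Fin N → (Fin N → ℝ) → ℝ → ℝ} {q : List ℝ → ℝ}
  {ρ : Equiv.Perm (Fin N)} {n : Fin N} {m : ℕ} {a : ℝ} {h : List ℝ} {c : EReal}
  {d₀ : Fin N → ℝ → List ℝ → EReal → Node N}

theorem belief_of_isRegular (hl : h.length = m) (hr : IsRegular P Y I V w ρ n m a h c) :
    belief P Y I V w ρ d₀ n a h c = (clockLaw P Y w ρ n m a h c).map (orderNode ρ n m) := by
  subst hl
  exact if_pos hr

theorem belief_of_not_isRegular (hr : ¬IsRegular P Y I V w ρ n h.length a h c) :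
    belief P Y I V w ρ d₀ n a h c = Measure.dirac (d₀ n a h c) :=
  if_neg hr

theorem IsRegular.ae_mem_reachSet (hw : Measurable w) (hr : IsRegular P Y I V w ρ n m a h c) :
    ∀ᵐ y ∂(clockLaw P Y w ρ n m a h c), y ∈ reachSet I w ρ n m a h c := by
  have hclock : MeasurableSet {y | c < (nextPrice w ρ n m y : ℝ)} :=
    measurableSet_lt measurable_const (measurable_coe_nextPrice hw ρ n m)
  filter_upwards [cond_absolutelyContinuous.ae_le hr.ae_observed, ae_cond_mem hclock]
    with y hy hlt using ⟨hy, hlt⟩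

theorem IsRegular.integrable_clockLaw (hr : IsRegular P Y I V w ρ n m a h c) :
    Integrable (stayUtility V w n) (clockLaw P Y w ρ n m a h c) :=
  (hr.integrable.restrict).smul_measure (ENNReal.inv_ne_top.2 hr.clock_ne_zero)

theorem IsRegular.isRationalBelief (R : IsPriceRule I w V) (hq : IsInference w I q)
    (hw : Measurable w) (hI : MeasurableSet (signalSpace N I)) (hl : h.length = m)
    (hm : m + 2 ≤ N) (hr : IsRegular P Y I V w ρ n m a h c) :
    IsRationalBelief I w V q ρ n a h c
      ((clockLaw P Y w ρ n m a h c).map (orderNode ρ n m)) := by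
  have he := measurableEmbedding_orderNode ρ n m
  have hmem := hr.ae_mem_reachSet hw
  have hprob : IsProbabilityMeasure (clockLaw P Y w ρ n m a h c) :=
    cond_isProbabilityMeasure hr.clock_ne_zero
  refine ⟨Measure.isProbabilityMeasure_map he.measurable.aemeasurable, he.ae_map_iff.2 ?_,
    he.ae_map_iff.2 ?_, fun σ hσ => he.ae_map_iff.2 ?_,
    integrable_nodePayoff_bid R hq hl hm hmem hr.integrable_clockLaw, fun σ hσ hn =>
    integrable_nodePayoff R hq hw hI hl hm hσ hn hmem hr.integrable_clockLaw⟩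
  all_goals filter_upwards [hmem] with y hy
  · have hc := isConsistent_of_mem_reachSet R hq hl hm hy
    exact ⟨hc.mem, congrArg Prod.fst hy.1.2, hc.active, hc.card⟩
  · exact (isConsistent_of_mem_reachSet R hq hl hm hy).dropped
  · exact nodePayoff_orderNode_le R hq hl hm hσ hy

theorem exists_isRationalBelief_dirac (R : IsPriceRule I w V) (hq : IsInference w I q)
    (ρ : Equiv.Perm (Fin N)) (n : Fin N) (hi : IsInfoSet N I a h c) :
    ∃ d : Node N, IsRationalBelief I w V q ρ n a h c (Measure.dirac d) := by
  obtain ⟨z, hz, hle⟩ := exists_forall_nodePayoff_pointNode_le R hq ρ n hi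
  have hl := hi.length_le
  have hql : (inferred q h).length < N := by rw [length_inferred]; omega
  have hcard : (pointNode n a z (inferred q h)).2.card + h.length = N := by
    simpa only [length_inferred] using card_pointNode_snd (n := n) (a := a) (z := z) hql.le
  refine ⟨pointNode n a z (inferred q h), Measure.dirac.isProbabilityMeasure, ?_, ?_,
    fun σ hσ => ?_, integrable_dirac enorm_lt_top, fun σ _ _ => integrable_dirac enorm_lt_top⟩
  all_goals rw [ae_dirac_eq]
  · exact ⟨pointNode_fst_mem hi.signal_mem hz (hq.inferred_mem h), pointNode_fst_self,
      mem_pointNode_snd hql, hcard⟩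
  · exact map_pointNode_dropped hql
  · exact hle σ hσ

end Belief

section Bayes

variable {Ω : Type*} [MeasurableSpace Ω] {P : Measure Ω} {N : ℕ} [NeZero N]
  {Y : Ω → Fin N → ℝ} {I : Set ℝ} {w : (Fin N → ℝ) → ℝ} {V : Fin N → (Fin N → ℝ) → ℝ → ℝ}
  {n : Fin N} {m : ℕ} {T : ℝ × (Fin m → ℝ) → EReal}

theorem measurable_clock_ofFn (m : ℕ) : Measurable fun x : Fin m → ℝ => clock (List.ofFn x) := by
  cases m with
  | zero => exact measurable_const
  | succ m =>
    simp only [List.ofFn_succ, clock]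
    exact (measurable_pi_apply 0).coe_real_ereal

theorem measurableSet_clockSet (hw : Measurable w) (ρ : Equiv.Perm (Fin N)) (n : Fin N)
    (hT : Measurable T) : MeasurableSet (clockSet w ρ n m T) :=
  (measurableSet_le (((measurable_clock_ofFn m).comp measurable_snd).comp measurable_fst)
    (hT.comp measurable_fst)).inter
  (measurableSet_lt (hT.comp measurable_fst) ((measurable_coe_nextPrice hw ρ n m).comp
    measurable_snd))

theorem ae_cond_clockSet (hY : Measurable Y) (hw : Measurable w) (ρ : Equiv.Perm (Fin N))
    (n : Fin N) (hT : Measurable T) :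
    ∀ᵐ ω ∂P[|{ω | (orderObserved w ρ n m (Y ω), Y ω) ∈ clockSet w ρ n m T}],
      {y | (orderObserved w ρ n m (Y ω), y) ∈ clockSet w ρ n m T}
        = {y | T (orderObserved w ρ n m (Y ω)) < (nextPrice w ρ n m y : ℝ)} := by
  have hO := (measurable_orderObserved hw ρ n m).comp hY
  filter_upwards [ae_cond_mem ((hO.prodMk hY) (measurableSet_clockSet hw ρ n hT))] with ω hω
  exact Set.ext fun y => and_iff_right hω.1

variable [IsFiniteMeasure P]

theorem ae_isRegular (hY : Measurable Y) (hYI : ∀ ω, Y ω ∈ signalSpace N I) (hw : Measurable w)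
    (hI : MeasurableSet (signalSpace N I)) (hV : Measurable (stayUtility V w n))
    (hint : Integrable (fun ω => stayUtility V w n (Y ω)) P) (ρ : Equiv.Perm (Fin N))
    (hT : Measurable T) :
    ∀ᵐ ω ∂P[|{ω | (orderObserved w ρ n m (Y ω), Y ω) ∈ clockSet w ρ n m T}],
      IsRegular P Y I V w ρ n m (Y ω n) (pricePath w ρ n (Y ω) m)
        (T (orderObserved w ρ n m (Y ω))) := by
  have hOm := measurable_orderObserved hw ρ n m
  have hO := hOm.comp hY
  have hobserved := ae_condDistrib (P := P) hY hO
    (p := fun z => z.2 ∈ signalSpace N I ∧ orderObserved w ρ n m z.2 = z.1)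
    ((measurable_snd hI).inter (measurableSet_eq_fun (hOm.comp measurable_snd) measurable_fst))
    (.of_forall fun ω => ⟨hYI ω, rfl⟩)
  have hintegrable : ∀ᵐ ω ∂P, Integrable (stayUtility V w n)
      (signalLaw P Y w ρ n m (orderObserved w ρ n m (Y ω))) :=
    Integrable.condDistrib_ae (f := fun z => stayUtility V w n z.2) hO.aemeasurable hY.aemeasurable
      ((integrable_map_measure (hV.comp measurable_snd).aestronglyMeasurable
        (hO.prodMk hY).aemeasurable).2 hint)
  have hac : P[|{ω | (orderObserved w ρ n m (Y ω), Y ω) ∈ clockSet w ρ n m T}] ≪ P :=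
    cond_absolutelyContinuous
  filter_upwards [hac.ae_le hobserved, hac.ae_le hintegrable, ae_cond_clockSet hY hw ρ n hT,
    ae_cond_condDistrib_ne_zero hY hO (measurableSet_clockSet hw ρ n hT)] with ω hobs hi hset hne
  exact ⟨hobs, hi, hset ▸ hne⟩

theorem belief_ae_eq_condExp (hY : Measurable Y) (hYI : ∀ ω, Y ω ∈ signalSpace N I)
    (hw : Measurable w) (hI : MeasurableSet (signalSpace N I))
    (hV : Measurable (stayUtility V w n))
    (hint : Integrable (fun ω => stayUtility V w n (Y ω)) P) (ρ : Equiv.Perm (Fin N))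
    (d₀ : Fin N → ℝ → List ℝ → EReal → Node N) (hT : Measurable T) {B : Set (Node N)}
    (hB : MeasurableSet B) :
    (fun ω => (belief P Y I V w ρ d₀ n (Y ω n) (pricePath w ρ n (Y ω) m)
        (T (orderObserved w ρ n m (Y ω)))).real B)
      =ᵐ[P[|{ω | (orderObserved w ρ n m (Y ω), Y ω) ∈ clockSet w ρ n m T}]]
    (P[|{ω | (orderObserved w ρ n m (Y ω), Y ω) ∈ clockSet w ρ n m T}])[
      {ω | orderNode ρ n m (Y ω) ∈ B}.indicator (fun _ => (1 : ℝ)) |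
      MeasurableSpace.comap (fun ω => orderObserved w ρ n m (Y ω)) inferInstance] := by
  have he := measurableEmbedding_orderNode ρ n m
  have hbayes := cond_condDistrib_ae_eq_condExp (P := P) hY
    ((measurable_orderObserved hw ρ n m).comp hY) (measurableSet_clockSet hw ρ n hT)
    (he.measurable hB)
  refine EventuallyEq.trans ?_ hbayes
  filter_upwards [ae_isRegular hY hYI hw hI hV hint ρ hT, ae_cond_clockSet hY hw ρ n hT]
    with ω hr hset
  rw [belief_of_isRegular (length_pricePath w ρ n (Y ω) m) hr, measureReal_def, he.map_apply,
    ← measureReal_def]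
  exact congrArg (fun s => (condDistrib Y _ P _)[|s].real (orderNode ρ n m ⁻¹' B)) hset.symm

end Bayes

section Equilibrium

variable {Ω : Type*} [MeasurableSpace Ω] {P : Measure Ω} [IsFiniteMeasure P] {N : ℕ} [NeZero N]
  {I : Set ℝ} {w : (Fin N → ℝ) → ℝ} {V : Fin N → (Fin N → ℝ) → ℝ → ℝ} {q : List ℝ → ℝ}
  {ρ : Equiv.Perm (Fin N)} {n : Fin N} {m : ℕ}

theorem exists_belief_isRationalBelief (P : Measure Ω) [IsFiniteMeasure P] (Y : Ω → Fin N → ℝ)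
    (R : IsPriceRule I w V) (hq : IsInference w I q) (hw : Measurable w)
    (hI : MeasurableSet (signalSpace N I)) (ρ : Equiv.Perm (Fin N)) :
    ∃ d₀ : Fin N → ℝ → List ℝ → EReal → Node N, ∀ n a h c, IsInfoSet N I a h c →
      IsRationalBelief I w V q ρ n a h c (belief P Y I V w ρ d₀ n a h c) := by
  have hdirac (n : Fin N) (a : ℝ) (h : List ℝ) (c : EReal) : ∃ d : Node N,
      IsInfoSet N I a h c → IsRationalBelief I w V q ρ n a h c (Measure.dirac d) := by
    by_cases hi : IsInfoSet N I a h c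
    · exact (exists_isRationalBelief_dirac R hq ρ n hi).imp fun d hd _ => hd
    · exact ⟨(0, ∅), fun hi' => absurd hi' hi⟩
  choose d₀ hd₀ using hdirac
  refine ⟨d₀, fun n a h c hi => ?_⟩
  by_cases hr : IsRegular P Y I V w ρ n h.length a h c
  · rw [belief_of_isRegular rfl hr]
    exact hr.isRationalBelief R hq hw hI rfl hi.length_le
  · rw [belief_of_not_isRegular hr]
    exact hd₀ n a h c hi

theorem IsRationalBelief.integral_update_le {a : ℝ} {h : List ℝ} {c : EReal}
    {ν : Measure (Node N)} (hν : IsRationalBelief I w V q ρ n a h c ν) {τ : Strategy}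
    (hτ : τ.IsMeasurable) :
    Integrable (nodePayoff V ρ (Function.update (fun _ => bid w q) n τ) n h c) ν ∧
    ∫ d, nodePayoff V ρ (Function.update (fun _ => bid w q) n τ) n h c d ∂ν
      ≤ ∫ d, nodePayoff V ρ (fun _ => bid w q) n h c d ∂ν := by
  have hothers : ∀ j ≠ n, Function.update (fun _ => bid w q) n τ j = bid w q :=
    fun j hj => Function.update_of_ne hj _ _
  have hint := hν.integrable _ hothers (by rwa [Function.update_self])
  exact ⟨hint, integral_mono_ae hint hν.integrable_bid (hν.ae_le _ hothers)⟩

theorem IsOnPath.observed_eq {y : Fin N → ℝ} (hp : IsOnPath w I q ρ n y m) :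
    observed ρ (fun _ => bid w q) n m y = orderObserved w ρ n m y := by
  rw [observed, hp.path_eq]
  rfl

theorem exists_isPBE {Y : Fin N → Ω → ℝ} (hY : ∀ i, Measurable (Y i)) (hYI : ∀ i ω, Y i ω ∈ I)
    (R : IsPriceRule I w V) (hq : IsInference w I q) (hw : Measurable w)
    (hI : MeasurableSet (signalSpace N I)) (hV : ∀ n, Measurable (stayUtility V w n))
    (hint : ∀ n, Integrable (fun ω => stayUtility V w n fun i => Y i ω) P)
    (ρ : Equiv.Perm (Fin N)) :
    ∃ μ : Beliefs N, IsPBE P Y I V ρ (fun _ => bid w q) μ ∧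
      ∀ n y h c, IsInfoSet N I y h c → ∀ᵐ d ∂(μ n y h c),
        (Finset.univ \ d.2).val.map d.1 = (inferred q h : Multiset ℝ) := by
  obtain ⟨d₀, hd₀⟩ :=
    exists_belief_isRationalBelief P (fun ω i => Y i ω) R hq hw hI ρ
  refine ⟨belief P (fun ω i => Y i ω) I V w ρ d₀, ⟨?_, ?_, ?_, ?_, ?_⟩, ?_⟩
  · exact fun n a h c hi => (hd₀ n a h c hi).isProbabilityMeasure
  · exact fun n a h c hi => (hd₀ n a h c hi).ae_node
  · rintro n m hm T hT _ rfl B hB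
    have hp (ω : Ω) : IsOnPath w I q ρ n (fun i => Y i ω) m :=
      isOnPath R hq ρ n (fun i => hYI i ω) (by omega)
    have hp' (ω : Ω) : IsOnPath w I q ρ n (fun i => Y i ω) (m + 1) :=
      isOnPath R hq ρ n (fun i => hYI i ω) hm
    have hbayes := belief_ae_eq_condExp (P := P) (measurable_pi_lambda _ hY)
      (fun ω i => hYI i ω) hw hI (hV n) (hint n) ρ d₀ hT hB
    simp only [clockSet, Set.mem_ofPred_eq, ofFn_orderObserved_snd] at hbayes
    simp only [(hp _).observed_eq, (hp _).path_eq, (hp' _).path_eq]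
    exact hbayes
  · exact fun n a h c hi => (hd₀ n a h c hi).integrable_bid
  · exact fun n a h c hi τ hτ => (hd₀ n a h c hi).integral_update_le hτ
  · exact fun n a h c hi => (hd₀ n a h c hi).ae_inferred

end Equilibrium

section Congruence

variable {N : ℕ} {I : Set ℝ} {σ σ' : Fin N → Strategy} {y : Fin N → ℝ}

theorem IsInference.congr {w w' : (Fin N → ℝ) → ℝ} {q : List ℝ → ℝ} (hq : IsInference w I q)
    (hw : Set.EqOn w w' (signalSpace N I)) : IsInference w' I q where
  mem := hq.mem
  solves p h hl := by
    have heq (b : ℝ) (hb : b ∈ I) : SignalEq w q h p b ↔ SignalEq w' q h p b := by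
      rw [SignalEq, SignalEq, hw (stack_mem hb (hq.inferred_mem h))]
    rintro ⟨b, hb, hsolves⟩
    exact (heq _ (hq.mem p h)).1 (hq.solves p h hl ⟨b, hb, (heq b hb).2 hsolves⟩)

theorem exitPrice_congr (hσ : ∀ i, σ i (y i) = σ' i (y i)) : exitPrice σ y = exitPrice σ' y := by
  funext h c i
  rw [exitPrice, exitPrice, hσ]

variable [NeZero N]

theorem play_congr (ρ : Equiv.Perm (Fin N)) (hσ : ∀ i, σ i (y i) = σ' i (y i)) (k : ℕ)
    (h : List ℝ) (c : EReal) (S : Finset (Fin N)) : play ρ σ y k h c S = play ρ σ' y k h c S := by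
  induction k generalizing h c S with
  | zero => rfl
  | succ k ih => rw [play, play, exitPrice_congr hσ, ih]

theorem pathStaying_congr (ρ : Equiv.Perm (Fin N)) (hσ : ∀ i, σ i (y i) = σ' i (y i)) (n : Fin N)
    (m : ℕ) : pathStaying ρ σ y n m = pathStaying ρ σ' y n m := by
  induction m with
  | zero => rfl
  | succ m ih => simp only [pathStaying, ih, exitPrice_congr hσ]

theorem nodePayoff_congr (V : Fin N → (Fin N → ℝ) → ℝ → ℝ) (ρ : Equiv.Perm (Fin N)) {d : Node N}
    (hσ : ∀ i, σ i (d.1 i) = σ' i (d.1 i)) (n : Fin N) (h : List ℝ) (c : EReal) :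
    nodePayoff V ρ σ n h c d = nodePayoff V ρ σ' n h c d := by
  rw [nodePayoff, nodePayoff, play_congr ρ hσ]

theorem IsPBE.congr {Ω : Type*} [MeasurableSpace Ω] {P : Measure Ω} {Y : Fin N → Ω → ℝ}
    {V : Fin N → (Fin N → ℝ) → ℝ → ℝ} {ρ : Equiv.Perm (Fin N)} {μ : Beliefs N}
    (H : IsPBE P Y I V ρ σ μ) (hYI : ∀ i ω, Y i ω ∈ I) (hσ : ∀ i, Set.EqOn (σ i) (σ' i) I) :
    IsPBE P Y I V ρ σ' μ := by
  have hpath (ω : Ω) := pathStaying_congr ρ fun i => hσ i (hYI i ω)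
  have hpayoff {n a h c} (hi : IsInfoSet N I a h c) :
      nodePayoff V ρ σ n h c =ᵐ[μ n a h c] nodePayoff V ρ σ' n h c := by
    filter_upwards [H.belief_support n a h c hi] with d hd
    exact nodePayoff_congr V ρ (fun i => hσ i (hd.1 i)) n h c
  refine ⟨H.belief_prob, H.belief_support, ?_, ?_, ?_⟩
  · rintro n m hm T hT _ rfl B hB
    simpa only [observed, hpath] using H.bayes n m hm T hT _ rfl B hB
  · exact fun n a h c hi => (H.payoff_integrable n a h c hi).congr (hpayoff hi)
  · intro n a h c hi τ hτ
    have hdeviation : nodePayoff V ρ (Function.update σ n τ) n h c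
        =ᵐ[μ n a h c] nodePayoff V ρ (Function.update σ' n τ) n h c := by
      filter_upwards [H.belief_support n a h c hi] with d hd
      refine nodePayoff_congr V ρ (fun i => ?_) n h c
      rcases eq_or_ne i n with rfl | hin
      · rw [Function.update_self, Function.update_self]
      · rw [Function.update_of_ne hin, Function.update_of_ne hin, hσ i (hd.1 i)]
    rw [← integrable_congr hdeviation, ← integral_congr_ae hdeviation,
      ← integral_congr_ae (hpayoff hi)]
    exact H.rational n a h c hi τ hτ

end Congruence

theorem lemma7_general {Ω : Type*} [MeasurableSpace Ω] (P : Measure Ω) [IsFiniteMeasure P]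
    (N : ℕ) [NeZero N] (hN : 2 ≤ N) (X Y : Fin N → Ω → ℝ) (I : Set ℝ)
    (κ : Fin N → Kernel (Fin N → ℝ) ℝ) (u : ℝ → ℝ) (hM : ConditionalModel P X Y I κ u)
    (C : Contract) (α : ℝ) (hα0 : 0 ≤ α) (hα1 : α < 1)
    (hfin : FiniteUtilities P X Y I κ u C α) (ρ : Equiv.Perm (Fin N)) :
    (∀ y ∈ signalSpace N I, ∃! b : ℝ, winUtility κ u C α 0 y b = 0) ∧
    (∀ qs : List ℝ, qs.length + 2 ≤ N → (∀ x ∈ qs, x ∈ I) →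
      Set.InjOn (fun b => indiffPrice κ u C α (stack N b qs)) I) ∧
    ∀ q : List ℝ → ℝ, IsInference (indiffPrice κ u C α) I q →
      (∀ (h : List ℝ) (p p' : ℝ), h.length + 3 ≤ N → p ≤ p' →
        (∃ b ∈ I, SignalEq (indiffPrice κ u C α) q h p b) →
        (∃ b ∈ I, SignalEq (indiffPrice κ u C α) q (p :: h) p' b) →
        q (p :: h) ≤ q (p' :: p :: h)) ∧
      ∃ μ : Beliefs N,
        IsPBE P Y I (winUtility κ u C α) ρ (fun _ => bid (indiffPrice κ u C α) q) μ ∧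
        ∀ n y h c, IsInfoSet N I y h c → ∀ᵐ d ∂(μ n y h c),
          (Finset.univ \ d.2).val.map d.1 = (inferred q h : Multiset ℝ) := by
  have R := hM.isPriceRule_indiffPrice hfin hα0 hα1
  refine ⟨fun _ hy => hM.existsUnique_winUtility_eq_zero hfin hα0 hα1 hy,
    fun _ hl hqs => (R.strictMonoOn_stack (by omega) hqs).injOn, fun q hq =>
    ⟨fun _ _ _ hl hp hs hs' => inference_le_inference_cons R hq hl hp hs hs', ?_⟩⟩
  have := hM.markov
  obtain ⟨w, hw, hws⟩ := hM.exists_measurable_eqOn_indiffPrice hfin hα0 hα1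
  obtain ⟨μ, hμ, hinferred⟩ := exists_isPBE hM.measurable_Y hM.signal_mem (R.congr hws.symm)
    (hq.congr hws.symm) hw (measurableSet_signalSpace hM.measurableSet_I)
    (fun n => measurable_winUtility n hM.increasing.monotone (measurable_finalPrice hw n))
    (fun n => hM.integrable_stayUtility hfin hN hw hws n) ρ
  refine ⟨μ, hμ.congr hM.signal_mem fun _ b hb => ?_, hinferred⟩
  funext h
  exact hws (stack_mem hb (hq.inferred_mem h))

end ProfitSharing

end

open ProfitSharing in
theorem lemma7 {Ω : Type*} [MeasurableSpace Ω] (P : Measure Ω) [IsProbabilityMeasure P]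
    (N : ℕ) [NeZero N] (hN : 2 ≤ N) (X Y : Fin N → Ω → ℝ) (I : Set ℝ) (f : (Fin N → ℝ) → ℝ)
    (κ : Fin N → Kernel (Fin N → ℝ) ℝ) (u : ℝ → ℝ) (hM : Model P X Y I f κ u)
    (C : Contract) (α : ℝ) (hα0 : 0 ≤ α) (hα1 : α < 1)
    (hfin : FiniteUtilities P X Y I κ u C α) (ρ : Equiv.Perm (Fin N)) :
    -- the function `s` (or `t`) is well defined
    (∀ y ∈ signalSpace N I, ∃! b : ℝ, winUtility κ u C α 0 y b = 0) ∧
    -- the equations for the `q_k` have at most one solution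
    (∀ qs : List ℝ, qs.length + 2 ≤ N → (∀ x ∈ qs, x ∈ I) →
      Set.InjOn (fun b => indiffPrice κ u C α (stack N b qs)) I) ∧
    ∀ q : List ℝ → ℝ, IsInference (indiffPrice κ u C α) I q →
      -- the inferred signals are ordered like the prices
      (∀ (h : List ℝ) (p p' : ℝ), h.length + 3 ≤ N → p ≤ p' →
        (∃ b ∈ I, SignalEq (indiffPrice κ u C α) q h p b) →
        (∃ b ∈ I, SignalEq (indiffPrice κ u C α) q (p :: h) p' b) →
        q (p :: h) ≤ q (p' :: p :: h)) ∧
      -- symmetric perfect Bayesian equilibrium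
      ∃ μ : Beliefs N,
        IsPBE P Y I (winUtility κ u C α) ρ (fun _ => bid (indiffPrice κ u C α) q) μ ∧
        -- in which the signals of those who have dropped out are believed to be the inferred ones
        ∀ n y h c, IsInfoSet N I y h c → ∀ᵐ d ∂(μ n y h c),
          (Finset.univ \ d.2).val.map d.1 = (inferred q h : Multiset ℝ) := by
  exact lemma7_general P N hN X Y I κ u hM.conditionalModel C α hα0 hα1 hfin ρ
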